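/- \textbf{Model.} Algorithms are fixed programs (independent of the input) for a unit-cost random access machine with a fixed number of registers and arrays of natural numbers. Its elementary steps are: assigning a constant, copying a register, adding or subtracting $1$, reading or writing an array cell whose index is held in a register, and comparing two registers ($=$, $\neq$, $<$); control flow is sequencing, if--then--else and while. All graphs are finite, simple and undirected, with vertices $0,\dots,n-1$. The edge set of the input graph is partitioned into two classes, and the input consists of $n$ together with, for each class and each vertex $i$, the list (in arbitrary order, stored in arrays) of the neighbours of $i$ along edges of that class; memory not occupied by the input is initially $0$. A tree is output as a list of its edges, each listed exactly once. \textbf{Theorem.} Let $G=(V,E)$ denote a connected graph and $m=|E|$. (a) There are a program and a constant $C$ such that for every connected graph $G$, every partition of $E$ into red edges $E_r$ and blue edges $E_b$, and every integer $k\ge 0$, the program, given $k$ and the red and the blue adjacency lists of $G$, halts after at most $C(m+1)$ steps, decides whether $G$ has a spanning tree with exactly $k$ red edges and, if there is one, outputs such a spanning tree. (b) There are a program and a constant $C$ such that for every connected graph $G$ with edge weights $w:E\to\{0,1\}$, the program, given the adjacency lists of the edges of weight $0$ and of the edges of weight $1$, halts after at most $C(m+1)$ steps and outputs a spanning tree of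 $G$ of minimum total weight. (c) The same as (b) with a spanning tree of maximum total weight. -/

import Mathlib

/-! ## Spanning trees of a graph whose edges are coloured or weighted -/

section Trees

variable {V : Type*}

/-- `T` is a spanning tree of `G` (both graphs have the same vertex set `V`). -/
def IsSpanningTree (G T : SimpleGraph V) : Prop :=
  T ≤ G ∧ T.IsTree

/-- `T` is a spanning tree of `G` that has exactly `k` edges in the set `Er` of red edges. -/
def IsKRedSpanningTree (G : SimpleGraph V) (Er : Set (Sym2 V)) (k : ℕ)
    (T : SimpleGraph V) : Prop :=
  IsSpanningTree G T ∧ (T.edgeSet ∩ Er).ncard = k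

open Classical in
/-- The total weight of the edges of a graph on a finite vertex set. -/
noncomputable def totalWeight [Fintype V] (w : Sym2 V → ℕ) (T : SimpleGraph V) : ℕ :=
  ∑ e ∈ T.edgeFinset, w e

/-- `T` is a spanning tree of `G` of minimum total weight. -/
def IsMinSpanningTree [Fintype V] (G : SimpleGraph V) (w : Sym2 V → ℕ)
    (T : SimpleGraph V) : Prop :=
  IsSpanningTree G T ∧ ∀ T', IsSpanningTree G T' → totalWeight w T ≤ totalWeight w T'

/-- `T` is a spanning tree of `G` of maximum total weight. -/
def IsMaxSpanningTree [Fintype V] (G : SimpleGraph V) (w : Sym2 V → ℕ)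
    (T : SimpleGraph V) : Prop :=
  IsSpanningTree G T ∧ ∀ T', IsSpanningTree G T' → totalWeight w T' ≤ totalWeight w T

end Trees

/-! ## A random access machine with unit cost

Structured programs on a random access memory.  The only arithmetic is adding one and subtracting
one, so after `t` steps no stored number exceeds the largest number in the input or the program
by more than `t`: unit cost hides no computation on long numbers. -/

namespace RAM

/-- The memory: registers `reg 0, reg 1, …` and arrays `arr 0, arr 1, …`, where `arr a i` is cell
`i` of array `a`.  A program names the registers and arrays that it uses, so these are finitely
many; cell indices are computed at run time. -/
@[ext]
structure State where
  reg : ℕ → ℕ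
  arr : ℕ → ℕ → ℕ

/-- The state after register `x` has received the value `v`. -/
def State.setReg (s : State) (x v : ℕ) : State :=
  { s with reg := Function.update s.reg x v }

/-- The state after cell `i` of array `a` has received the value `v`. -/
def State.setArr (s : State) (a i v : ℕ) : State :=
  { s with arr := Function.update s.arr a (Function.update (s.arr a) i v) }

/-- Tests compare the contents of two registers. -/
inductive Test where
  | eq (x y : ℕ)
  | ne (x y : ℕ)
  | lt (x y : ℕ)

/-- The test is true in the state. -/
def Test.Holds : Test → State → Prop
  | .eq x y, s => s.reg x = s.reg y
  | .ne x y, s => s.reg x ≠ s.reg y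
  | .lt x y, s => s.reg x < s.reg y

/-- Programs. -/
inductive Cmd where
  /-- do nothing -/
  | skip
  /-- `reg x := c` for a literal `c` -/
  | const (x c : ℕ)
  /-- `reg x := reg y` -/
  | copy (x y : ℕ)
  /-- `reg x := reg y + 1` -/
  | succ (x y : ℕ)
  /-- `reg x := reg y - 1` (and `0` if `reg y = 0`) -/
  | pred (x y : ℕ)
  /-- `reg x := arr a (reg y)` -/
  | load (x a y : ℕ)
  /-- `arr a (reg x) := reg y` -/
  | store (a x y : ℕ)
  /-- first `p`, then `q` -/
  | seq (p q : Cmd)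
  /-- if `b` then `p` else `q` -/
  | cond (b : Test) (p q : Cmd)
  /-- while `b` do `p` -/
  | loop (b : Test) (p : Cmd)

/-- `Exec p s t s'`: the program `p`, started in state `s`, halts after exactly `t` steps in
state `s'`.  Every elementary command and every evaluation of a test is one step. -/
inductive Exec : Cmd → State → ℕ → State → Prop
  | skip (s : State) : Exec .skip s 1 s
  | const (s : State) (x c : ℕ) : Exec (.const x c) s 1 (s.setReg x c)
  | copy (s : State) (x y : ℕ) : Exec (.copy x y) s 1 (s.setReg x (s.reg y))
  | succ (s : State) (x y : ℕ) : Exec (.succ x y) s 1 (s.setReg x (s.reg y + 1))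
  | pred (s : State) (x y : ℕ) : Exec (.pred x y) s 1 (s.setReg x (s.reg y - 1))
  | load (s : State) (x a y : ℕ) : Exec (.load x a y) s 1 (s.setReg x (s.arr a (s.reg y)))
  | store (s : State) (a x y : ℕ) : Exec (.store a x y) s 1 (s.setArr a (s.reg x) (s.reg y))
  | seq {p q : Cmd} {s₁ s₂ s₃ : State} {t₁ t₂ : ℕ} :
      Exec p s₁ t₁ s₂ → Exec q s₂ t₂ s₃ → Exec (.seq p q) s₁ (t₁ + t₂) s₃
  | cond_true {b : Test} {p q : Cmd} {s s' : State} {t : ℕ} :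
      b.Holds s → Exec p s t s' → Exec (.cond b p q) s (t + 1) s'
  | cond_false {b : Test} {p q : Cmd} {s s' : State} {t : ℕ} :
      ¬ b.Holds s → Exec q s t s' → Exec (.cond b p q) s (t + 1) s'
  | loop_true {b : Test} {p : Cmd} {s₁ s₂ s₃ : State} {t₁ t₂ : ℕ} :
      b.Holds s₁ → Exec p s₁ t₁ s₂ → Exec (.loop b p) s₂ t₂ s₃ →
        Exec (.loop b p) s₁ (t₁ + t₂ + 1) s₃
  | loop_false {b : Test} {p : Cmd} {s : State} :
      ¬ b.Holds s → Exec (.loop b p) s 1 s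

/-- The machine is deterministic: the number of steps and the final state are determined by the
program and the initial state. -/
theorem Exec.deterministic {p : Cmd} {s s₁ s₂ : State} {t₁ t₂ : ℕ}
    (h₁ : Exec p s t₁ s₁) (h₂ : Exec p s t₂ s₂) : t₁ = t₂ ∧ s₁ = s₂ := by
  induction h₁ generalizing t₂ s₂ with
  | skip => cases h₂; exact ⟨rfl, rfl⟩
  | const => cases h₂; exact ⟨rfl, rfl⟩
  | copy => cases h₂; exact ⟨rfl, rfl⟩
  | succ => cases h₂; exact ⟨rfl, rfl⟩
  | pred => cases h₂; exact ⟨rfl, rfl⟩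
  | load => cases h₂; exact ⟨rfl, rfl⟩
  | store => cases h₂; exact ⟨rfl, rfl⟩
  | seq _ _ ih₁ ih₂ =>
    cases h₂ with
    | seq g₁ g₂ =>
      obtain ⟨rfl, rfl⟩ := ih₁ g₁
      obtain ⟨rfl, rfl⟩ := ih₂ g₂
      exact ⟨rfl, rfl⟩
  | cond_true hb _ ih =>
    cases h₂ with
    | cond_true _ g =>
      obtain ⟨rfl, rfl⟩ := ih g
      exact ⟨rfl, rfl⟩
    | cond_false nb _ => exact absurd hb nb
  | cond_false nb _ ih =>
    cases h₂ with
    | cond_true hb _ => exact absurd hb nb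
    | cond_false _ g =>
      obtain ⟨rfl, rfl⟩ := ih g
      exact ⟨rfl, rfl⟩
  | loop_true hb _ _ ih₁ ih₂ =>
    cases h₂ with
    | loop_true _ g₁ g₂ =>
      obtain ⟨rfl, rfl⟩ := ih₁ g₁
      obtain ⟨rfl, rfl⟩ := ih₂ g₂
      exact ⟨rfl, rfl⟩
    | loop_false nb => exact absurd hb nb
  | loop_false nb =>
    cases h₂ with
    | loop_true hb _ _ => exact absurd hb nb
    | loop_false _ => exact ⟨rfl, rfl⟩

/-! ### Input and output of graphs -/

/-- The lists `L i`, in any order, are adjacency lists of the edge set `E`: the list of vertex `i`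
contains each neighbour of `i` along edges of `E` exactly once, and nothing else. -/
def IsAdjLists {n : ℕ} (E : Set (Sym2 (Fin n))) (L : Fin n → List (Fin n)) : Prop :=
  ∀ i, (L i).Nodup ∧ ∀ j, j ∈ L i ↔ s(i, j) ∈ E

/-- Array in which the list of vertex `i` begins at cell `offsets L i` of the array `targets L`
and ends before cell `offsets L (i + 1)`. -/
def offsets {n : ℕ} (L : Fin n → List (Fin n)) (i : ℕ) : ℕ :=
  if i ≤ n then ∑ j : Fin n with j.val < i, (L j).length else 0

/-- The lists `L 0, L 1, …, L (n - 1)` written one after the other into an array. -/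
def targets {n : ℕ} (L : Fin n → List (Fin n)) (p : ℕ) : ℕ :=
  ((List.ofFn L).flatten.map Fin.val).getD p 0

/-- The initial state: `n` and `k` in registers `0` and `1`, the first family of adjacency lists in
arrays `0` (offsets) and `1` (targets), the second one in arrays `2` and `3`, and `0` everywhere
else. -/
def input (n k : ℕ) (L₀ L₁ : Fin n → List (Fin n)) : State where
  reg x := match x with
    | 0 => n
    | 1 => k
    | _ => 0
  arr a := match a with
    | 0 => offsets L₀
    | 1 => targets L₀
    | 2 => offsets L₁
    | 3 => targets L₁
    | _ => fun _ => 0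

/-- The state presents the graph `T` as output: register `3` holds the number of edges of `T`, and
cells `j` of arrays `4` and `5` hold the ends of its edge number `j`, each edge being listed
exactly once. -/
def Outputs {n : ℕ} (s : State) (T : SimpleGraph (Fin n)) : Prop :=
  ∃ l : List (Fin n × Fin n),
    s.reg 3 = l.length ∧
    (∀ (j : ℕ) (h : j < l.length), s.arr 4 j = (l[j]).1.val ∧ s.arr 5 j = (l[j]).2.val) ∧
    (l.map fun e => s(e.1, e.2)).Nodup ∧
    ∀ e : Sym2 (Fin n), e ∈ (l.map fun e => s(e.1, e.2)) ↔ e ∈ T.edgeSet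

end RAM

/-! ## Forests and spanning trees -/

namespace SimpleGraph

variable {V : Type*}

/-! Everything rests on one linear-time search. Given edge classes `H₀` and `H₁` with connected
union, it grows a tree from a root and scans `H₁` only while no unscanned edge of `H₀` leaves a
visited vertex. It yields a spanning tree `T₀ ∪ T₁` in which `T₀` spans every component of `H₀`
(`IsPriorityTree`). A forest has at most as many edges as any graph that connects the ends of each
of its edges (`SimpleGraph.IsAcyclic.ncard_edgeSet_le`), so no spanning tree has more edges in `H₀`
than `T₀`. As all spanning trees have equally many edges, none has fewer than `|T₁|` outside `H₀`.
For weights in `{0, 1}` this settles the minimum (weight 0 preferred) and the maximum (weight 1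
preferred).

For exactly `k` red edges, a search preferring red yields a largest red forest `A₀`. A second search
prefers blue and takes red edges from `A₀` only; its red part `B₁ ⊆ A₀` is as small as the red part
of a spanning tree can be. So `|B₁| ≤ k ≤ |A₀|` is necessary (`IsPriorityTree.red_bounds`). If it
holds, choose `R` with `B₁ ⊆ R ⊆ A₀` and `|R| = k`. Then `R` is a forest that connects the graph
together with the blue edges, and a third search preferring `R` to blue keeps all of `R`
(`IsPriorityTree.isKRedSpanningTree`).

The search is analysed on abstract configurations: `Config.Inv` gives correctness, and
`Config.spent` grows by one per step while staying below the total length of the lists plus one per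
vertex and class. The relation `RAM.Rel` ties configurations to machine states, and
`RAM.exists_step_scanCmd` matches the steps. Linear time follows since a connected graph has at most
`m + 1` vertices. -/

theorem Reachable.of_forall_adj {F T : SimpleGraph V}
    (h : ∀ x y, F.Adj x y → T.Reachable x y) {x y : V} (hxy : F.Reachable x y) :
    T.Reachable x y := by
  obtain ⟨p⟩ := hxy
  induction p with
  | nil => exact Reachable.refl _
  | cons hadj _ ih => exact (h _ _ hadj).trans ih

/-- A forest all of whose edges join vertices connected in `T` has at most as many edges
as `T`. -/
theorem IsAcyclic.ncard_edgeSet_le [Finite V] [Nonempty V] {F T : SimpleGraph V}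
    (hF : F.IsAcyclic) (h : ∀ x y, F.Adj x y → T.Reachable x y) :
    F.edgeSet.ncard ≤ T.edgeSet.ncard := by
  -- Exchange argument: extend `F` to a spanning tree `S` of the complete graph. Replacing `F` by
  -- `T` inside `S` leaves it connected, so it still has at least `|V| - 1 = |S|` edges.
  obtain ⟨S, hFS, -, hS⟩ :=
    (connected_top (V := V)).exists_isTree_le_of_le_of_isAcyclic le_top hF
  have hconn : (T ⊔ (S \ F)).Connected := by
    refine ⟨fun x y => ?_⟩
    refine Reachable.of_forall_adj (F := S) (fun a b hab => ?_) (hS.connected.preconnected x y)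
    by_cases hf : F.Adj a b
    · exact (h a b hf).mono le_sup_left
    · exact Adj.reachable (Or.inr ⟨hab, hf⟩)
  have h1 := hconn.card_vert_le_card_edgeSet_add_one
  have h2 := (isTree_iff_connected_and_card.1 hS).2
  rw [Nat.card_coe_set_eq] at h1 h2
  rw [edgeSet_sup, edgeSet_sdiff] at h1
  have h3 := Set.ncard_union_le T.edgeSet (S.edgeSet \ F.edgeSet)
  have h4 := Set.ncard_sdiff_add_ncard_of_subset (edgeSet_mono hFS) (Set.toFinite _)
  omega

end SimpleGraph

/-- `T₀ ∪ T₁` is a spanning tree of `H₀ ∪ H₁`, with edges `T₀` from `H₀` and `T₁` from `H₁`, in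
which `T₀` connects whatever `H₀` connects. -/
structure IsPriorityTree {V : Type*} (H₀ H₁ T₀ T₁ : SimpleGraph V) : Prop where
  le₀ : T₀ ≤ H₀
  le₁ : T₁ ≤ H₁
  isTree : (T₀ ⊔ T₁).IsTree
  reach : ∀ x y, H₀.Adj x y → T₀.Reachable x y

/-! ### Edge counts of priority trees -/

namespace IsPriorityTree

variable {V : Type*} {H₀ H₁ T₀ T₁ : SimpleGraph V}

/-- The part of `T` in `H₀` is a forest, and `T₀` connects the ends of each of its edges. -/
theorem ncard_le [Finite V] [Nonempty V] (h : IsPriorityTree H₀ H₁ T₀ T₁) {T : SimpleGraph V}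
    (hT : T.IsTree) : (T.edgeSet ∩ H₀.edgeSet).ncard ≤ T₀.edgeSet.ncard := by
  have h1 : (T ⊓ H₀).IsAcyclic := hT.isAcyclic.anti inf_le_left
  rw [← SimpleGraph.edgeSet_inf]
  exact h1.ncard_edgeSet_le fun x y hxy => h.reach x y hxy.2

theorem ncard_add_ncard [Finite V] (h : IsPriorityTree H₀ H₁ T₀ T₁)
    (hd : Disjoint H₀.edgeSet H₁.edgeSet) :
    T₀.edgeSet.ncard + T₁.edgeSet.ncard + 1 = Nat.card V := by
  have h2 := (SimpleGraph.isTree_iff_connected_and_card.1 h.isTree).2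
  rw [Nat.card_coe_set_eq, SimpleGraph.edgeSet_sup, Set.ncard_union_eq] at h2
  · exact h2
  · exact hd.mono (SimpleGraph.edgeSet_mono h.le₀) (SimpleGraph.edgeSet_mono h.le₁)

theorem inter_left (h : IsPriorityTree H₀ H₁ T₀ T₁) (hd : Disjoint H₀.edgeSet H₁.edgeSet) :
    (T₀ ⊔ T₁).edgeSet ∩ H₀.edgeSet = T₀.edgeSet := by
  have h0 := SimpleGraph.edgeSet_mono h.le₀
  have h1 := SimpleGraph.edgeSet_mono h.le₁
  rw [SimpleGraph.edgeSet_sup]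
  ext e
  constructor
  · rintro ⟨he | he, he'⟩
    · exact he
    · exact absurd (h1 he) (Set.disjoint_left.1 hd he')
  · exact fun he => ⟨Or.inl he, h0 he⟩

theorem inter_right (h : IsPriorityTree H₀ H₁ T₀ T₁) (hd : Disjoint H₀.edgeSet H₁.edgeSet) :
    (T₀ ⊔ T₁).edgeSet ∩ H₁.edgeSet = T₁.edgeSet := by
  have h0 := SimpleGraph.edgeSet_mono h.le₀
  have h1 := SimpleGraph.edgeSet_mono h.le₁
  rw [SimpleGraph.edgeSet_sup]
  ext e
  constructor
  · rintro ⟨he | he, he'⟩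
    · exact absurd he' (Set.disjoint_left.1 hd (h0 he))
    · exact he
  · exact fun he => ⟨Or.inr he, h1 he⟩

/-- The edges that a spanning tree of `H₀ ∪ H₁` takes from `H₁` are at least as many as those
that a priority tree takes from `H₁`. -/
theorem le_ncard [Finite V] [Nonempty V] (h : IsPriorityTree H₀ H₁ T₀ T₁)
    {T : SimpleGraph V} {E₀ E₁ : Set (Sym2 V)} (hd : Disjoint H₀.edgeSet H₁.edgeSet)
    (hT : T.IsTree) (hE : T.edgeSet ⊆ E₀ ∪ E₁) (hE₀ : E₀ ⊆ H₀.edgeSet) :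
    T₁.edgeSet.ncard ≤ (T.edgeSet ∩ E₁).ncard := by
  have h1 := h.ncard_le hT
  have h2 := h.ncard_add_ncard hd
  have h3 := (SimpleGraph.isTree_iff_connected_and_card.1 hT).2
  rw [Nat.card_coe_set_eq] at h3
  -- Both trees have `|V| - 1` edges, so the upper bound inside `H₀` becomes a lower bound outside.
  -- Edges of `T` in `E₁` need not lie in `H₁`.
  have h4 : T.edgeSet ⊆ (T.edgeSet ∩ H₀.edgeSet) ∪ (T.edgeSet ∩ E₁) := by
    intro e he
    rcases hE he with h | h
    · exact Or.inl ⟨he, hE₀ h⟩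
    · exact Or.inr ⟨he, h⟩
  have h5 := Set.ncard_le_ncard h4 (Set.toFinite _)
  have h6 := Set.ncard_union_le (T.edgeSet ∩ H₀.edgeSet) (T.edgeSet ∩ E₁)
  omega

end IsPriorityTree

/-! ### Priority trees for weights 0 and 1 -/

section Weights

variable {V : Type*} [Fintype V]

theorem totalWeight_eq_ncard {w : Sym2 V → ℕ} {T : SimpleGraph V}
    (hw : ∀ e ∈ T.edgeSet, w e = 0 ∨ w e = 1) :
    totalWeight w T = (T.edgeSet ∩ {e | w e = 1}).ncard := by
  classical
  have h1 : T.edgeSet ∩ {e | w e = 1} = ↑(T.edgeFinset.filter fun e => w e = 1) := by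
    ext e; simp
  rw [h1, Set.ncard_coe_finset, Finset.card_filter, totalWeight]
  refine Finset.sum_congr rfl fun e he => ?_
  rcases hw e (by simpa using he) with h | h <;> simp [h]

variable {G H₀ H₁ T₀ T₁ : SimpleGraph V} {w : Sym2 V → ℕ}

/-- The total weight counts the edges of weight 1, and a tree that prefers weight 0 has the fewest
of them. -/
theorem IsPriorityTree.isMinSpanningTree [Nonempty V] (h : IsPriorityTree H₀ H₁ T₀ T₁)
    (hw : ∀ e ∈ G.edgeSet, w e = 0 ∨ w e = 1)
    (h₀ : H₀.edgeSet = {e ∈ G.edgeSet | w e = 0}) (h₁ : H₁.edgeSet = {e ∈ G.edgeSet | w e = 1}) :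
    IsMinSpanningTree G w (T₀ ⊔ T₁) := by
  have hd : Disjoint H₀.edgeSet H₁.edgeSet := by
    rw [h₀, h₁, Set.disjoint_left]
    rintro e ⟨_, h⟩ ⟨_, h'⟩
    omega
  have hG : T₀ ⊔ T₁ ≤ G := by
    refine sup_le (h.le₀.trans ?_) (h.le₁.trans ?_) <;> rw [← SimpleGraph.edgeSet_subset_edgeSet]
    · rw [h₀]; exact fun e he => he.1
    · rw [h₁]; exact fun e he => he.1
  refine ⟨⟨hG, h.isTree⟩, fun T' hT' => ?_⟩
  have hsub := SimpleGraph.edgeSet_mono hG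
  have hsub' := SimpleGraph.edgeSet_mono hT'.1
  rw [totalWeight_eq_ncard fun e he => hw e (hsub he),
    totalWeight_eq_ncard fun e he => hw e (hsub' he)]
  have e1 : (T₀ ⊔ T₁).edgeSet ∩ {e | w e = 1} = (T₀ ⊔ T₁).edgeSet ∩ H₁.edgeSet := by
    rw [h₁]; ext e; exact ⟨fun h => ⟨h.1, hsub h.1, h.2⟩, fun h => ⟨h.1, h.2.2⟩⟩
  rw [e1, h.inter_right hd]
  refine h.le_ncard hd hT'.2 (E₀ := H₀.edgeSet) (fun e he => ?_) subset_rfl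
  rcases hw e (hsub' he) with h | h
  · left; rw [h₀]; exact ⟨hsub' he, h⟩
  · right; exact h

theorem IsPriorityTree.isMaxSpanningTree [Nonempty V] (h : IsPriorityTree H₁ H₀ T₁ T₀)
    (hw : ∀ e ∈ G.edgeSet, w e = 0 ∨ w e = 1)
    (h₀ : H₀.edgeSet = {e ∈ G.edgeSet | w e = 0}) (h₁ : H₁.edgeSet = {e ∈ G.edgeSet | w e = 1}) :
    IsMaxSpanningTree G w (T₁ ⊔ T₀) := by
  have hd : Disjoint H₁.edgeSet H₀.edgeSet := by
    rw [h₀, h₁, Set.disjoint_left]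
    rintro e ⟨_, h⟩ ⟨_, h'⟩
    omega
  have hG : T₁ ⊔ T₀ ≤ G := by
    refine sup_le (h.le₀.trans ?_) (h.le₁.trans ?_) <;> rw [← SimpleGraph.edgeSet_subset_edgeSet]
    · rw [h₁]; exact fun e he => he.1
    · rw [h₀]; exact fun e he => he.1
  refine ⟨⟨hG, h.isTree⟩, fun T' hT' => ?_⟩
  have hsub := SimpleGraph.edgeSet_mono hG
  have hsub' := SimpleGraph.edgeSet_mono hT'.1
  rw [totalWeight_eq_ncard fun e he => hw e (hsub he),
    totalWeight_eq_ncard fun e he => hw e (hsub' he)]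
  have aux : ∀ T : SimpleGraph V, T.edgeSet ⊆ G.edgeSet →
      T.edgeSet ∩ {e | w e = 1} = T.edgeSet ∩ H₁.edgeSet := fun T hT => by
    rw [h₁]; ext e; exact ⟨fun h => ⟨h.1, hT h.1, h.2⟩, fun h => ⟨h.1, h.2.2⟩⟩
  rw [aux _ hsub, aux _ hsub', h.inter_left hd]
  exact h.ncard_le hT'.2

end Weights

/-! ### The possible numbers of red edges -/

section RedEdges

variable {V : Type*} [Finite V] [Nonempty V] {G Hr Hb A₀ A₁ B₀ B₁ : SimpleGraph V}

/-- The number of red edges of a spanning tree lies between the number `|B₁|` of red edges of one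
that prefers blue edges and the number `|A₀|` of red edges of one that prefers red edges. -/
theorem IsPriorityTree.red_bounds (hG : G = Hr ⊔ Hb) (hd : Disjoint Hr.edgeSet Hb.edgeSet)
    (hA : IsPriorityTree Hr Hb A₀ A₁) (hB : IsPriorityTree Hb A₀ B₀ B₁)
    {T : SimpleGraph V} {k : ℕ} (hT : IsKRedSpanningTree G Hr.edgeSet k T) :
    B₁.edgeSet.ncard ≤ k ∧ k ≤ A₀.edgeSet.ncard := by
  obtain ⟨⟨hTG, hT⟩, rfl⟩ := hT
  have hsub := SimpleGraph.edgeSet_mono hTG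
  rw [hG, SimpleGraph.edgeSet_sup, Set.union_comm] at hsub
  -- The lower bound is valid for all spanning trees of `G`, although the second search saw only the
  -- red edges in `A₀`.
  exact ⟨hB.le_ncard (hd.symm.mono_right (SimpleGraph.edgeSet_mono hA.le₀)) hT hsub subset_rfl,
    hA.ncard_le hT⟩

/-- A red forest with `k` edges that connects everything together with the blue edges extends to
a spanning tree with exactly `k` red edges. -/
theorem IsPriorityTree.isKRedSpanningTree {R C₀ C₁ : SimpleGraph V} (hG : G = Hr ⊔ Hb)
    (hd : Disjoint Hr.edgeSet Hb.edgeSet) (hA : IsPriorityTree Hr Hb A₀ A₁) (hRA : R ≤ A₀)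
    (hC : IsPriorityTree R Hb C₀ C₁) :
    IsKRedSpanningTree G Hr.edgeSet R.edgeSet.ncard (C₀ ⊔ C₁) := by
  have hR : R.IsAcyclic := hA.isTree.isAcyclic.anti (hRA.trans le_sup_left)
  have hRr := hRA.trans hA.le₀
  refine ⟨⟨?_, hC.isTree⟩, ?_⟩
  · rw [hG]; exact sup_le_sup (hC.le₀.trans hRr) hC.le₁
  · have h1 : (C₀ ⊔ C₁).edgeSet ∩ Hr.edgeSet = C₀.edgeSet := by
      have h0 := SimpleGraph.edgeSet_mono (hC.le₀.trans hRr)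
      have h1 := SimpleGraph.edgeSet_mono hC.le₁
      rw [SimpleGraph.edgeSet_sup]
      ext e
      constructor
      · rintro ⟨he | he, he'⟩
        · exact he
        · exact absurd (h1 he) (Set.disjoint_left.1 hd he')
      · exact fun he => ⟨Or.inl he, h0 he⟩
    rw [h1]
    -- `C₀ ≤ R` connects whatever `R` connects and `R` is a forest, so no edge of `R` is lost.
    exact le_antisymm
      (Set.ncard_le_ncard (SimpleGraph.edgeSet_mono hC.le₀) (Set.toFinite _))
      (hR.ncard_edgeSet_le hC.reach)

end RedEdges

/-! ## Executing programs -/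

namespace RAM

instance (b : Test) (s : State) : Decidable (b.Holds s) :=
  match b with
  | .eq x y => inferInstanceAs (Decidable (s.reg x = s.reg y))
  | .ne x y => inferInstanceAs (Decidable (s.reg x ≠ s.reg y))
  | .lt x y => inferInstanceAs (Decidable (s.reg x < s.reg y))

@[simp] theorem State.reg_setReg (s : State) (x v y : ℕ) :
    (s.setReg x v).reg y = if y = x then v else s.reg y := by
  simp [State.setReg, Function.update_apply]

@[simp] theorem State.arr_setReg (s : State) (x v : ℕ) : (s.setReg x v).arr = s.arr := rfl

@[simp] theorem State.reg_setArr (s : State) (a i v : ℕ) : (s.setArr a i v).reg = s.reg := rfl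

@[simp] theorem State.arr_setArr (s : State) (a i v b : ℕ) :
    (s.setArr a i v).arr b = if b = a then Function.update (s.arr a) i v else s.arr b := by
  simp [State.setArr, Function.update_apply]

namespace Cmd

/-- The program contains no loop. -/
def LoopFree : Cmd → Prop
  | seq p q => p.LoopFree ∧ q.LoopFree
  | cond _ p q => p.LoopFree ∧ q.LoopFree
  | loop _ _ => False
  | _ => True

/-- An upper bound for the number of steps of a loop-free program. -/
def size : Cmd → ℕ
  | seq p q => p.size + q.size
  | cond _ p q => p.size + q.size + 1
  | _ => 1

/-- The state after a loop-free program. -/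
def run : Cmd → State → State
  | skip, s => s
  | const x c, s => s.setReg x c
  | copy x y, s => s.setReg x (s.reg y)
  | succ x y, s => s.setReg x (s.reg y + 1)
  | pred x y, s => s.setReg x (s.reg y - 1)
  | load x a y, s => s.setReg x (s.arr a (s.reg y))
  | store a x y, s => s.setArr a (s.reg x) (s.reg y)
  | seq p q, s => q.run (p.run s)
  | cond b p q, s => if b.Holds s then p.run s else q.run s
  | loop _ _, s => s

/-- Commands executed one after the other. -/
def block : List Cmd → Cmd
  | [] => skip
  | p :: l => seq p (block l)

@[simp] theorem run_skip (s : State) : skip.run s = s := rfl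
@[simp] theorem run_const (s : State) (x c : ℕ) : (const x c).run s = s.setReg x c := rfl
@[simp] theorem run_copy (s : State) (x y : ℕ) : (copy x y).run s = s.setReg x (s.reg y) := rfl
@[simp] theorem run_succ (s : State) (x y : ℕ) :
    (succ x y).run s = s.setReg x (s.reg y + 1) := rfl
@[simp] theorem run_pred (s : State) (x y : ℕ) :
    (pred x y).run s = s.setReg x (s.reg y - 1) := rfl
@[simp] theorem run_load (s : State) (x a y : ℕ) :
    (load x a y).run s = s.setReg x (s.arr a (s.reg y)) := rfl
@[simp] theorem run_store (s : State) (a x y : ℕ) :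
    (store a x y).run s = s.setArr a (s.reg x) (s.reg y) := rfl
@[simp] theorem run_seq (s : State) (p q : Cmd) : (seq p q).run s = q.run (p.run s) := rfl
@[simp] theorem run_cond_eq (s : State) (x y : ℕ) (p q : Cmd) :
    (cond (.eq x y) p q).run s = if s.reg x = s.reg y then p.run s else q.run s := rfl
@[simp] theorem run_cond_lt (s : State) (x y : ℕ) (p q : Cmd) :
    (cond (.lt x y) p q).run s = if s.reg x < s.reg y then p.run s else q.run s := rfl
@[simp] theorem run_block_nil (s : State) : (block []).run s = s := rfl
@[simp] theorem run_block_cons (s : State) (p : Cmd) (l : List Cmd) :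
    (block (p :: l)).run s = (block l).run (p.run s) := rfl

theorem exec_run {p : Cmd} (hp : p.LoopFree) (s : State) :
    ∃ t, t ≤ p.size ∧ Exec p s t (p.run s) := by
  induction p generalizing s with
  | skip => exact ⟨1, le_rfl, .skip s⟩
  | const x c => exact ⟨1, le_rfl, .const s x c⟩
  | copy x y => exact ⟨1, le_rfl, .copy s x y⟩
  | succ x y => exact ⟨1, le_rfl, .succ s x y⟩
  | pred x y => exact ⟨1, le_rfl, .pred s x y⟩
  | load x a y => exact ⟨1, le_rfl, .load s x a y⟩
  | store a x y => exact ⟨1, le_rfl, .store s a x y⟩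
  | seq p q ihp ihq =>
    obtain ⟨t₁, h₁, e₁⟩ := ihp hp.1 s
    obtain ⟨t₂, h₂, e₂⟩ := ihq hp.2 (p.run s)
    exact ⟨_, Nat.add_le_add h₁ h₂, .seq e₁ e₂⟩
  | cond b p q ihp ihq =>
    by_cases hb : b.Holds s
    · obtain ⟨t, h, e⟩ := ihp hp.1 s
      refine ⟨t + 1, by simp only [size]; omega, ?_⟩
      rw [run, if_pos hb]
      exact .cond_true hb e
    · obtain ⟨t, h, e⟩ := ihq hp.2 s
      refine ⟨t + 1, by simp only [size]; omega, ?_⟩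
      rw [run, if_neg hb]
      exact .cond_false hb e
  | loop b p => exact hp.elim

/-- A loop whose body is loop-free, with an invariant `I` and a decreasing measure `μ` on ghost
values. -/
theorem exec_loop {γ : Type*} {b : Test} {p : Cmd} (hp : p.LoopFree) (I : γ → State → Prop)
    (μ : γ → ℕ)
    (step : ∀ g s, I g s → b.Holds s → ∃ g', I g' (p.run s) ∧ μ g' < μ g)
    (g : γ) (s : State) (h : I g s) :
    ∃ t s' g', Exec (loop b p) s t s' ∧ I g' s' ∧ ¬ b.Holds s' ∧
      t ≤ (p.size + 1) * μ g + 1 := by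
  induction hm : μ g using Nat.strong_induction_on generalizing g s with
  | _ m ih =>
    subst hm
    by_cases hb : b.Holds s
    · obtain ⟨g₁, h₁, hlt⟩ := step g s h hb
      obtain ⟨t₁, ht₁, e₁⟩ := exec_run hp s
      obtain ⟨t₂, s₂, g₂, e₂, h₂, hb₂, ht₂⟩ := ih _ hlt g₁ _ h₁ rfl
      refine ⟨_, s₂, g₂, .loop_true hb e₁ e₂, h₂, hb₂, ?_⟩
      -- One round costs one test and at most `p.size` steps, paid for by the drop of the measure;
      -- the final failing test is the `+ 1`.
      have : (p.size + 1) * (μ g₁ + 1) ≤ (p.size + 1) * μ g := Nat.mul_le_mul_left _ hlt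
      rw [Nat.mul_add] at this
      omega
    · exact ⟨1, s, g, .loop_false hb, h, hb, by omega⟩

/-- A counting loop: register `x` runs from `0` to the value `n` of register `y`. -/
theorem exec_count {x y n : ℕ} {p : Cmd} (hp : p.LoopFree) (I : ℕ → State → Prop)
    (hx : ∀ i s, I i s → s.reg x = i) (hy : ∀ i s, I i s → s.reg y = n)
    (step : ∀ i s, I i s → i < n → I (i + 1) (p.run s)) (s : State) (h : I 0 s) :
    ∃ t s', Exec (loop (.lt x y) p) s t s' ∧ I n s' ∧ t ≤ (p.size + 1) * n + 1 := by
  obtain ⟨t, s', i, e, ⟨h', hi⟩, hb, ht⟩ := exec_loop hp (b := .lt x y)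
    (fun i s => I i s ∧ i ≤ n) (fun i => n - i)
    (fun i s hi hb => by
      have hb' : s.reg x < s.reg y := hb
      rw [hx i s hi.1, hy i s hi.1] at hb'
      exact ⟨i + 1, ⟨step i s hi.1 hb', hb'⟩, by omega⟩) 0 s ⟨h, Nat.zero_le n⟩
  have hb' : ¬ s'.reg x < s'.reg y := hb
  rw [hx i s' h', hy i s' h'] at hb'
  obtain rfl : i = n := by omega
  exact ⟨t, s', e, h', by simpa using ht⟩

end Cmd

/-! ## Adjacency lists in arrays -/

section AdjacencyArrays

variable {n : ℕ} (L : Fin n → List (Fin n))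

theorem offsets_succ (u : Fin n) : offsets L (u + 1) = offsets L u + (L u).length := by
  unfold offsets
  rw [if_pos (Nat.succ_le_of_lt u.2), if_pos u.2.le]
  have : (Finset.univ.filter fun j : Fin n => j.val < u + 1) =
      insert u (Finset.univ.filter fun j : Fin n => j.val < u) := by
    ext j
    simp only [Finset.mem_filter, Finset.mem_univ, true_and, Finset.mem_insert, Fin.ext_iff]
    omega
  rw [this, Finset.sum_insert (by simp), add_comm]

theorem offsets_zero : offsets L 0 = 0 := by
  simp [offsets]

/-- Locates a whole list in the concatenation, a form that admits induction on `i`; single cells are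
read off from it. -/
theorem drop_offsets_flatten (i : ℕ) (hi : i ≤ n) :
    (List.ofFn L).flatten.drop (offsets L i) = ((List.ofFn L).drop i).flatten := by
  induction i with
  | zero => simp [offsets_zero]
  | succ i ih =>
    have h := offsets_succ L ⟨i, hi⟩
    have h2 := ih (by omega)
    rw [List.drop_eq_getElem_cons (by simpa using hi : i < (List.ofFn L).length),
      List.flatten_cons, List.getElem_ofFn] at h2
    simp only at h
    rw [h, ← List.drop_drop, h2, List.drop_left]

theorem targets_offsets_add (u : Fin n) (q : ℕ) (hq : q < (L u).length) :
    targets L (offsets L u + q) = ((L u)[q]).val := by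
  unfold targets
  have h := drop_offsets_flatten L u u.2.le
  rw [List.drop_eq_getElem_cons (by simp : u.val < (List.ofFn L).length),
      List.flatten_cons, List.getElem_ofFn] at h
  have h1 : (List.ofFn L).flatten[offsets L u + q]? = some ((L u)[q]) := by
    rw [← List.getElem?_drop, h, List.getElem?_append_left hq, List.getElem?_eq_getElem hq]
  rw [List.getD_eq_getElem?_getD, List.getElem?_map, h1]
  rfl

end AdjacencyArrays

end RAM

/-! ## Priority search

The search keeps the list of the visited vertices.  For each of two classes of edges a pointer runs
through this list, and a second pointer through the neighbours of the vertex at the first pointer.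
Edges of class `true` are scanned only while those of class `false` are exhausted. -/

/-- A configuration of the search: the tree edges (parent, child, class), and for each class the
position `p` in the list of visited vertices and the position `q` in an adjacency list. -/
structure Config (n : ℕ) where
  edges : List (Fin n × Fin n × Bool)
  p : Bool → ℕ
  q : Bool → ℕ

namespace Config

variable {n : ℕ}

/-- The visited vertices. -/
def order (r : Fin n) (g : Config n) : List (Fin n) :=
  r :: g.edges.map fun e => e.2.1

/-- Visited vertex number `i`. -/
def ord (r : Fin n) (g : Config n) (i : ℕ) : Fin n :=
  (g.order r).getD i r

/-- The tree edges of class `c`. -/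
def tree (g : Config n) (c : Bool) : SimpleGraph (Fin n) :=
  SimpleGraph.fromRel fun u v => (u, v, c) ∈ g.edges

/-- The edge from visited vertex number `i` to `y` is known to have been scanned. -/
def Scanned (r : Fin n) (L : Bool → Fin n → List (Fin n)) (g : Config n) (c : Bool) (i : ℕ)
    (y : Fin n) : Prop :=
  i < g.p c ∨ i = g.p c ∧ y ∈ (L c (g.ord r i)).take (g.q c)

/-- The initial configuration. -/
def init (n : ℕ) : Config n := ⟨[], fun _ => 0, fun _ => 0⟩

/-- Go on to the next vertex. -/
def advance (g : Config n) (c : Bool) : Config n :=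
  ⟨g.edges, Function.update g.p c (g.p c + 1), Function.update g.q c 0⟩

/-- Go on to the next neighbour. -/
def skip (g : Config n) (c : Bool) : Config n :=
  ⟨g.edges, g.p, Function.update g.q c (g.q c + 1)⟩

/-- Add the edge from `u` to `v` to the tree. -/
def visit (g : Config n) (c : Bool) (u v : Fin n) : Config n :=
  ⟨g.edges ++ [(u, v, c)], g.p, Function.update g.q c (g.q c + 1)⟩

/-- The invariant of the search. -/
structure Inv (r : Fin n) (H : Bool → SimpleGraph (Fin n)) (L : Bool → Fin n → List (Fin n))
    (g : Config n) : Prop where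
  nodup : (g.order r).Nodup
  p_le_p : g.p true ≤ g.p false
  p_le : g.p false ≤ g.edges.length + 1
  q_le : ∀ c, g.p c ≤ g.edges.length → g.q c ≤ (L c (g.ord r (g.p c))).length
  -- A pointer past the end waits for the next visited vertex, whose list must then be read from its
  -- beginning.
  q_eq : ∀ c, g.edges.length < g.p c → g.q c = 0
  valid : ∀ u v c, (u, v, c) ∈ g.edges → (H c).Adj u v ∧ u ∈ g.order r
  nodup_edges : (g.edges.map fun e => s(e.1, e.2.1)).Nodup
  conn : ∀ v ∈ g.order r, (g.tree false ⊔ g.tree true).Reachable r v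
  -- At the end of the search every edge is scanned: the first half then gives spanning, the second
  -- the priority of class `false`.
  closed : ∀ c i y, i ≤ g.edges.length → (H c).Adj (g.ord r i) y → g.Scanned r L c i y →
    y ∈ g.order r ∧ (c = false → (g.tree false).Reachable (g.ord r i) y)
  -- The vertices from the `false` pointer onwards lie in one component of the `false` tree: a
  -- `true` edge starts a new component only when this segment is empty.
  fresh : ∀ i, g.p false ≤ i → i ≤ g.edges.length →
    (g.tree false).Reachable (g.ord r (g.p false)) (g.ord r i)

variable {r : Fin n} {H : Bool → SimpleGraph (Fin n)} {L : Bool → Fin n → List (Fin n)}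
  {g : Config n} {c : Bool}

theorem length_order (g : Config n) : (g.order r).length = g.edges.length + 1 := by
  simp [order]

theorem ord_eq_getElem {i : ℕ} (h : i < (g.order r).length) :
    g.ord r i = (g.order r)[i] := by
  rw [ord, List.getD_eq_getElem _ _ h]

theorem ord_zero : g.ord r 0 = r := by
  simp [ord, order]

theorem ord_mem {i : ℕ} (h : i ≤ g.edges.length) : g.ord r i ∈ g.order r := by
  rw [ord_eq_getElem (by rw [length_order]; omega)]
  exact List.getElem_mem _

theorem exists_ord_eq {v : Fin n} (h : v ∈ g.order r) : ∃ i ≤ g.edges.length, g.ord r i = v := by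
  obtain ⟨i, hi, rfl⟩ := List.getElem_of_mem h
  refine ⟨i, ?_, ord_eq_getElem hi⟩
  rw [length_order] at hi
  omega

theorem order_visit (u v : Fin n) : (g.visit c u v).order r = g.order r ++ [v] := by
  simp [order, visit]

theorem ord_visit (u v : Fin n) {i : ℕ} (h : i ≤ g.edges.length) :
    (g.visit c u v).ord r i = g.ord r i := by
  rw [ord, ord, order_visit, List.getD_append _ _ _ _ (by rw [length_order]; omega)]

theorem ord_visit_last (u v : Fin n) :
    (g.visit c u v).ord r (g.edges.length + 1) = v := by
  rw [ord, order_visit, List.getD_append_right _ _ _ _ (by rw [length_order]), length_order]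
  simp

theorem Inv.ord_inj (h : g.Inv r H L) {i j : ℕ} (hi : i ≤ g.edges.length)
    (hj : j ≤ g.edges.length) (hij : g.ord r i = g.ord r j) : i = j := by
  rw [ord_eq_getElem (by rw [length_order]; omega),
    ord_eq_getElem (by rw [length_order]; omega)] at hij
  exact (h.nodup.getElem_inj_iff).1 hij

theorem tree_le_visit (u v : Fin n) (d : Bool) : g.tree d ≤ (g.visit c u v).tree d := by
  intro a b hab
  simp only [tree, SimpleGraph.fromRel_adj, visit, List.mem_append] at hab ⊢
  exact ⟨hab.1, hab.2.imp Or.inl Or.inl⟩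

theorem visit_adj {u v : Fin n} (h : u ≠ v) : ((g.visit c u v).tree c).Adj u v := by
  simp [tree, SimpleGraph.fromRel_adj, visit, h]

theorem Inv.p_le_length (h : g.Inv r H L) (c : Bool) : g.p c ≤ g.edges.length + 1 := by
  cases c
  · exact h.p_le
  · exact h.p_le_p.trans h.p_le

theorem inv_init (r : Fin n) : (init n).Inv r H L where
  nodup := by simp [init, order]
  p_le_p := le_rfl
  p_le := Nat.zero_le _
  q_le _ _ := Nat.zero_le _
  q_eq _ _ := rfl
  valid := by simp [init]
  nodup_edges := by simp [init]
  conn := by simp [init, order]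
  closed := by simp [init, Scanned]
  fresh i _ hi := by
    obtain rfl : i = 0 := by simpa [init] using hi
    exact SimpleGraph.Reachable.refl _

/-- The vertex that is left has its list read to the end, so all its edges count as scanned. The
condition `hc` keeps the `true` pointer from overtaking the other one. -/
theorem Inv.advance (h : g.Inv r H L) (hL : ∀ c u v, (H c).Adj u v → v ∈ L c u)
    (hp : g.p c ≤ g.edges.length) (hc : c = true → g.edges.length < g.p false)
    (hq : g.q c = (L c (g.ord r (g.p c))).length) : (g.advance c).Inv r H L where
  nodup := h.nodup
  p_le_p := by
    have := h.p_le_p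
    cases c
    · simp [Config.advance]; omega
    · have := hc rfl
      simp [Config.advance]; omega
  p_le := by
    have := h.p_le
    cases c <;> simp [Config.advance] <;> omega
  q_le d hd := by
    by_cases hdc : d = c
    · subst hdc; simp [Config.advance]
    · simp only [Config.advance, Function.update_of_ne hdc] at hd ⊢
      exact h.q_le d hd
  q_eq d hd := by
    by_cases hdc : d = c
    · subst hdc; simp [Config.advance]
    · simp only [Config.advance, Function.update_of_ne hdc] at hd ⊢
      exact h.q_eq d hd
  valid := h.valid
  nodup_edges := h.nodup_edges
  conn := h.conn
  closed d i y hi hy hs := by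
    refine h.closed d i y hi hy ?_
    by_cases hdc : d = c
    · subst hdc
      simp only [Scanned, Config.advance, Function.update_self, List.take_zero, List.not_mem_nil,
        and_false, or_false] at hs
      rcases Nat.lt_succ_iff_lt_or_eq.1 hs with hs | rfl
      · exact Or.inl hs
      · refine Or.inr ⟨rfl, ?_⟩
        rw [hq, List.take_length]
        exact hL _ _ _ hy
    · simp only [Scanned, Config.advance, Function.update_of_ne hdc] at hs
      exact hs
  fresh i hi hi' := by
    cases c
    · simp only [Config.advance, Function.update_self] at hi hi' ⊢
      exact (h.fresh (g.p false + 1) (by omega) (by omega)).symm.trans (h.fresh i (by omega) hi')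
    · exact h.fresh i (by simpa [Config.advance] using hi) hi'

theorem mem_take_succ {α : Type*} {l : List α} {q : ℕ} (hq : q < l.length) {y : α}
    (h : y ∈ l.take (q + 1)) : y ∈ l.take q ∨ y = l[q] := by
  rwa [List.take_succ_eq_append_getElem hq, List.mem_append, List.mem_singleton] at h

/-- The point is an edge of class `false` whose far end is already visited. If the far end lies
before the pointer, the edge was scanned from there and `closed` applies by symmetry; otherwise
`fresh` applies. -/
theorem Inv.skip (h : g.Inv r H L) (hp : g.p c ≤ g.edges.length)
    (hq : g.q c < (L c (g.ord r (g.p c))).length)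
    (hv : (H c).Adj (g.ord r (g.p c)) (L c (g.ord r (g.p c)))[g.q c] →
      (L c (g.ord r (g.p c)))[g.q c] ∈ g.order r) : (g.skip c).Inv r H L where
  nodup := h.nodup
  p_le_p := h.p_le_p
  p_le := h.p_le
  q_le d hd := by
    by_cases hdc : d = c
    · subst hdc
      simp only [Config.skip, Function.update_self]
      exact hq
    · simp only [Config.skip, Function.update_of_ne hdc] at hd ⊢
      exact h.q_le d hd
  q_eq d hd := by
    by_cases hdc : d = c
    · subst hdc; exact absurd hd (by simpa [Config.skip] using hp)
    · simp only [Config.skip, Function.update_of_ne hdc] at hd ⊢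
      exact h.q_eq d hd
  valid := h.valid
  nodup_edges := h.nodup_edges
  conn := h.conn
  closed d i y hi hy hs := by
    by_cases hdc : d = c
    · subst hdc
      simp only [Scanned, Config.skip, Function.update_self] at hs
      rcases hs with hs | ⟨rfl, hs⟩
      · exact h.closed d i y hi hy (Or.inl hs)
      · rcases mem_take_succ (l := L d (g.ord r (g.p d))) hq hs with hs | rfl
        · exact h.closed d _ y hi hy (Or.inr ⟨rfl, hs⟩)
        · have hmem := hv hy
          refine ⟨hmem, ?_⟩
          rintro rfl
          obtain ⟨j, hj, hj'⟩ := exists_ord_eq hmem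
          change (g.tree false).Reachable (g.ord r (g.p false)) _
          rw [← hj']
          rcases lt_or_ge j (g.p false) with hlt | hge
          · refine ((h.closed false j (g.ord r (g.p false)) hj ?_ (Or.inl hlt)).2 rfl).symm
            rw [hj']
            exact hy.symm
          · exact h.fresh j hge hj
    · simp only [Scanned, Config.skip, Function.update_of_ne hdc] at hs
      exact h.closed d i y hi hy hs
  fresh := h.fresh

/-- The delicate field is `fresh`. A `false` edge ties the new vertex to the one at the `false`
pointer; a `true` edge is used only if that pointer has passed all visited vertices, and then the
new vertex is the only fresh one. -/
theorem Inv.visit (h : g.Inv r H L) (hp : g.p c ≤ g.edges.length)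
    (hc : c = true → g.edges.length < g.p false)
    (hq : g.q c < (L c (g.ord r (g.p c))).length)
    (hadj : (H c).Adj (g.ord r (g.p c)) (L c (g.ord r (g.p c)))[g.q c])
    (hv : (L c (g.ord r (g.p c)))[g.q c] ∉ g.order r) :
    (g.visit c (g.ord r (g.p c)) (L c (g.ord r (g.p c)))[g.q c]).Inv r H L := by
  set u := g.ord r (g.p c) with hu
  set v := (L c u)[g.q c] with hv'
  have hlen : (g.visit c u v).edges.length = g.edges.length + 1 := by simp [Config.visit]
  have hnew : ((g.visit c u v).tree c).Adj u v := visit_adj hadj.ne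
  have hsup : g.tree false ⊔ g.tree true ≤ (g.visit c u v).tree false ⊔ (g.visit c u v).tree true :=
    sup_le_sup (tree_le_visit _ _ _) (tree_le_visit _ _ _)
  have hmono : ∀ {x}, x ∈ g.order r → x ∈ (g.visit c u v).order r := fun hx => by
    rw [order_visit]; exact List.mem_append_left _ hx
  have hum : u ∈ g.order r := ord_mem hp
  constructor
  · rw [order_visit]
    exact h.nodup.append (List.nodup_singleton _) (by simpa using hv)
  · exact h.p_le_p
  · have := h.p_le
    rw [hlen]
    exact this.trans (Nat.le_succ _)
  · intro d hd
    have hpd : g.p d ≤ g.edges.length + 1 := h.p_le_length d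
    by_cases hdc : d = c
    · subst hdc
      change Function.update g.q d (g.q d + 1) d ≤ (L d ((g.visit d u v).ord r (g.p d))).length
      rw [ord_visit _ _ hp, Function.update_self]
      exact hq
    · change Function.update g.q c (g.q c + 1) d ≤ (L d ((g.visit c u v).ord r (g.p d))).length
      rw [Function.update_of_ne hdc]
      rcases Nat.lt_or_ge g.edges.length (g.p d) with h1 | h1
      · rw [h.q_eq d h1]; exact Nat.zero_le _
      · rw [ord_visit _ _ h1]
        exact h.q_le d h1
  · intro d hd
    have hpd : g.p d ≤ g.edges.length + 1 := h.p_le_length d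
    rw [hlen] at hd
    exact absurd hd (not_lt.2 hpd)
  · intro a b d hab
    simp only [Config.visit, List.mem_append, List.mem_singleton, Prod.mk.injEq] at hab
    rcases hab with hab | ⟨rfl, rfl, rfl⟩
    · exact ⟨(h.valid a b d hab).1, hmono (h.valid a b d hab).2⟩
    · exact ⟨hadj, hmono hum⟩
  · simp only [Config.visit, List.map_append, List.map_cons, List.map_nil]
    refine h.nodup_edges.append (List.nodup_singleton _) ?_
    simp only [List.disjoint_singleton, List.mem_map, Prod.exists, not_exists, not_and]
    intro a b d hab heq
    have hb : b ∈ g.order r := List.mem_cons_of_mem _ (List.mem_map.2 ⟨_, hab, rfl⟩)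
    rcases Sym2.eq_iff.1 heq with ⟨_, h2⟩ | ⟨h1, _⟩
    · exact hv (h2 ▸ hb)
    · exact hv (h1 ▸ (h.valid a b d hab).2)
  · intro x hx
    rw [order_visit, List.mem_append, List.mem_singleton] at hx
    rcases hx with hx | rfl
    · exact (h.conn x hx).mono hsup
    · refine ((h.conn u hum).mono hsup).trans (SimpleGraph.Adj.reachable ?_)
      cases c
      · exact Or.inl hnew
      · exact Or.inr hnew
  · intro d i y hi hy hs
    have hpd : g.p d ≤ g.edges.length + 1 := h.p_le_length d
    rw [hlen] at hi
    have key : i ≤ g.edges.length → (H d).Adj (g.ord r i) y → g.Scanned r L d i y →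
        y ∈ (g.visit c u v).order r ∧
          (d = false → ((g.visit c u v).tree false).Reachable (g.ord r i) y) := fun h1 h2 h3 =>
      ⟨hmono (h.closed d i y h1 h2 h3).1,
        fun h4 => ((h.closed d i y h1 h2 h3).2 h4).mono (tree_le_visit _ _ _)⟩
    rcases hs with hs | ⟨hs, hs'⟩
    · have hs1 : i < g.p d := hs
      have hi' : i ≤ g.edges.length := by omega
      rw [ord_visit _ _ hi'] at hy ⊢
      exact key hi' hy (Or.inl hs1)
    · have hs1 : i = g.p d := hs
      by_cases hdc : d = c
      · subst hdc
        have hi' : i ≤ g.edges.length := by omega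
        rw [ord_visit _ _ hi'] at hy hs' ⊢
        simp only [Config.visit, Function.update_self] at hs'
        subst hs1
        rcases mem_take_succ hq hs' with hs' | rfl
        · exact key hi' hy (Or.inr ⟨rfl, hs'⟩)
        · refine ⟨by rw [order_visit]; simp [hv', hu], ?_⟩
          rintro rfl
          exact hnew.reachable
      · have hs2 : y ∈ (L d ((g.visit c u v).ord r i)).take (g.q d) := by
          simpa only [Config.visit, Function.update_of_ne hdc] using hs'
        -- The pointer of the other class may stand exactly at the new vertex, but then nothing of
        -- that list has been read.
        rcases Nat.lt_or_ge g.edges.length (g.p d) with h1 | h1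
        · rw [h.q_eq d h1] at hs2
          simp at hs2
        · have hi' : i ≤ g.edges.length := by omega
          rw [ord_visit _ _ hi'] at hy hs2 ⊢
          exact key hi' hy (Or.inr ⟨hs1, hs2⟩)
  · intro i hi hi'
    change g.p false ≤ i at hi
    rw [hlen] at hi'
    change ((g.visit c u v).tree false).Reachable ((g.visit c u v).ord r (g.p false)) _
    rcases Nat.lt_or_ge g.edges.length i with h1 | h1
    · obtain rfl : i = g.edges.length + 1 := by omega
      cases c
      · rw [ord_visit_last, ord_visit _ _ hp]
        exact hnew.reachable
      · have := hc rfl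
        have h2 : g.p false = g.edges.length + 1 := by have := h.p_le; omega
        rw [h2]
    · rw [ord_visit _ _ h1, ord_visit _ _ (hi.trans h1)]
      exact (h.fresh i hi h1).mono (tree_le_visit _ _ _)

/-! ### The number of steps -/

/-- The number of steps that led to a configuration. -/
def spent (r : Fin n) (L : Bool → Fin n → List (Fin n)) (g : Config n) (c : Bool) : ℕ :=
  ∑ i ∈ Finset.range (g.p c), ((L c (g.ord r i)).length + 1) + g.q c

/-- Visited vertices are distinct, so each list is paid for at most once; the extra one per vertex
pays for moving the pointer on. -/
theorem Inv.spent_le (h : g.Inv r H L) (c : Bool) :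
    g.spent r L c ≤ ∑ v, ((L c v).length + 1) := by
  have key : ∀ k ≤ g.edges.length + 1,
      ∑ i ∈ Finset.range k, ((L c (g.ord r i)).length + 1) ≤ ∑ v, ((L c v).length + 1) := by
    intro k hk
    rw [← Finset.sum_image (f := fun v => (L c v).length + 1) (g := g.ord r)]
    · exact Finset.sum_le_univ_sum_of_nonneg fun _ => Nat.zero_le _
    · intro i hi j hj hij
      have hi' := Finset.mem_range.1 hi
      have hj' := Finset.mem_range.1 hj
      exact h.ord_inj (by omega) (by omega) hij
  unfold spent
  rcases Nat.lt_or_ge g.edges.length (g.p c) with h1 | h1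
  · rw [h.q_eq c h1]
    exact key _ (h.p_le_length c)
  · have h2 := key (g.p c + 1) (by omega)
    have h3 := h.q_le c h1
    rw [Finset.sum_range_succ] at h2
    omega

theorem spent_advance (hq : g.q c = (L c (g.ord r (g.p c))).length) :
    (g.advance c).spent r L c = g.spent r L c + 1 := by
  simp only [spent, advance, Function.update_self, Finset.sum_range_succ, hq]
  simp only [ord, order]
  omega

theorem spent_advance_of_ne {d : Bool} (hd : d ≠ c) :
    (g.advance c).spent r L d = g.spent r L d := by
  simp only [spent, advance, Function.update_of_ne hd]
  rfl

theorem spent_skip : (g.skip c).spent r L c = g.spent r L c + 1 := by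
  simp only [spent, skip, Function.update_self]
  rfl

theorem spent_skip_of_ne {d : Bool} (hd : d ≠ c) :
    (g.skip c).spent r L d = g.spent r L d := by
  simp only [spent, skip, Function.update_of_ne hd]
  rfl

theorem Inv.spent_visit (h : g.Inv r H L) (u v : Fin n) (d : Bool) :
    (g.visit c u v).spent r L d = (g.skip c).spent r L d := by
  unfold spent
  congr 1
  refine Finset.sum_congr rfl fun i hi => ?_
  have h1 : i < g.p d := Finset.mem_range.1 hi
  have h2 := h.p_le_length d
  rw [ord_visit _ _ (by omega)]
  rfl

/-! ### The result -/

/-- Once the `true` pointer has passed all visited vertices, so has the `false` one, and `closed`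
makes the visited set closed under adjacency. -/
theorem Inv.mem_order (h : g.Inv r H L) (hH : (H false ⊔ H true).Connected)
    (hp : g.edges.length < g.p true) (v : Fin n) : v ∈ g.order r := by
  have hp' := h.p_le_p
  have step : ∀ x y, x ∈ g.order r → (H false ⊔ H true).Adj x y → y ∈ g.order r := by
    intro x y hx hxy
    obtain ⟨i, hi, rfl⟩ := exists_ord_eq hx
    rcases hxy with hxy | hxy
    · exact (h.closed false i y hi hxy (Or.inl (by omega))).1
    · exact (h.closed true i y hi hxy (Or.inl (by omega))).1
  obtain ⟨w⟩ := hH.preconnected r v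
  have : ∀ x y (_ : (H false ⊔ H true).Walk x y), x ∈ g.order r → y ∈ g.order r := by
    intro x y w
    induction w with
    | nil => exact id
    | cons hadj _ ih => exact fun hx => ih (step _ _ hx hadj)
  exact this r v w (by simp [order])

theorem Inv.mem_edgeSet_iff (h : g.Inv r H L) (e : Sym2 (Fin n)) :
    e ∈ (g.edges.map fun e => s(e.1, e.2.1)) ↔ e ∈ (g.tree false ⊔ g.tree true).edgeSet := by
  induction e with
  | _ x y =>
    simp only [List.mem_map, Prod.exists, SimpleGraph.mem_edgeSet, SimpleGraph.sup_adj, tree,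
      SimpleGraph.fromRel_adj]
    constructor
    · rintro ⟨a, b, c, hab, heq⟩
      have hne := (h.valid a b c hab).1.ne
      rcases Sym2.eq_iff.1 heq with ⟨rfl, rfl⟩ | ⟨rfl, rfl⟩ <;> cases c <;>
        simp [hne, hne.symm, hab]
    · rintro (⟨_, hab | hab⟩ | ⟨_, hab | hab⟩)
      · exact ⟨_, _, _, hab, rfl⟩
      · exact ⟨_, _, _, hab, Sym2.eq_swap⟩
      · exact ⟨_, _, _, hab, rfl⟩
      · exact ⟨_, _, _, hab, Sym2.eq_swap⟩

/-- The tree property comes from counting: the graph is connected, and each edge contributes exactly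
one vertex other than the root. -/
theorem Inv.isPriorityTree (h : g.Inv r H L) (hH : (H false ⊔ H true).Connected)
    (hp : g.edges.length < g.p true) :
    IsPriorityTree (H false) (H true) (g.tree false) (g.tree true) := by
  have hle : ∀ c, g.tree c ≤ H c := by
    intro c x y hxy
    rcases ((SimpleGraph.fromRel_adj _ _ _).1 hxy).2 with hxy | hxy
    · exact (h.valid _ _ _ hxy).1
    · exact (h.valid _ _ _ hxy).1.symm
  have hmem := h.mem_order hH hp
  refine ⟨hle _, hle _, ?_, ?_⟩
  · have : Nonempty (Fin n) := ⟨r⟩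
    rw [SimpleGraph.isTree_iff_connected_and_card]
    refine ⟨⟨fun x y => (h.conn x (hmem x)).symm.trans (h.conn y (hmem y))⟩, ?_⟩
    have h1 : (g.tree false ⊔ g.tree true).edgeSet =
        ↑(g.edges.map fun e => s(e.1, e.2.1)).toFinset := by
      ext e
      rw [← h.mem_edgeSet_iff]
      simp
    rw [Nat.card_coe_set_eq, h1, Set.ncard_coe_finset, List.toFinset_card_of_nodup h.nodup_edges,
      List.length_map, ← length_order (r := r), ← List.toFinset_card_of_nodup h.nodup]
    have : (g.order r).toFinset = Finset.univ := by
      ext v; simp [hmem v]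
    rw [this]
    simp
  · intro x y hxy
    obtain ⟨i, hi, rfl⟩ := exists_ord_eq (hmem x)
    have := h.p_le_p
    exact (h.closed false i y hi hxy (Or.inl (by omega))).2 rfl

end Config

/-! ## The search as a program -/

namespace RAM

open Cmd

/-- Register of the pointer of class `c`. -/
def ptr (c : Bool) : ℕ := bif c then 6 else 5

/-- Array of the positions in the adjacency lists of class `c`. -/
def posArr (w : ℕ) (c : Bool) : ℕ := w + (bif c then 3 else 2)

/-- Array of the parents (plus one) along tree edges of class `c`. -/
def parArr (w : ℕ) (c : Bool) : ℕ := w + (bif c then 5 else 4)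

/-- Load the vertex at the pointer, its current slot and the end of its list. -/
def fetchCmd (a : Bool → ℕ) (w : ℕ) (c : Bool) : Cmd :=
  block [load 7 (w + 1) (ptr c), load 8 (posArr w c) 7, succ 9 7, load 9 (a c) 9]

/-- Load the next neighbour. -/
def nextCmd (a : Bool → ℕ) (w : ℕ) (c : Bool) : Cmd :=
  block [load 10 (a c + 1) 8, succ 8 8, store (posArr w c) 7 8]

/-- Visit a vertex. -/
def visitCmd (a : Bool → ℕ) (w : ℕ) (c : Bool) : Cmd :=
  block [const 12 1, store w 10 12, store (w + 1) 4 10, succ 4 4,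
    store 4 3 7, store 5 3 10, succ 3 3,
    succ 12 7, store (parArr w c) 10 12,
    load 12 (a false) 10, store (posArr w false) 10 12,
    load 12 (a true) 10, store (posArr w true) 10 12]

/-- One step of the search in class `c`; the program `f c` sets register `11` to `1` if the edge
from register `7` to register `10` is to be used, and to `0` otherwise. -/
def scanCmd (a : Bool → ℕ) (f : Bool → Cmd) (w : ℕ) (c : Bool) : Cmd :=
  block [fetchCmd a w c,
    cond (.lt 8 9)
      (block [nextCmd a w c, f c, load 12 w 10, cond (.lt 12 11) (visitCmd a w c) skip])
      (succ (ptr c) (ptr c))]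

/-- Initialisation of the search. -/
def initCmd (w : ℕ) : Cmd :=
  block [const 3 0, const 4 1, const 5 0, const 6 0, const 7 0, const 8 1, store w 7 8]

/-- Body of the main loop of the search. -/
def bodyCmd (a : Bool → ℕ) (f : Bool → Cmd) (w : ℕ) : Cmd :=
  cond (.lt 5 4) (scanCmd a f w false) (scanCmd a f w true)

/-- The priority search, with the adjacency lists of class `c` in arrays `a c` and `a c + 1` and
working space in the arrays `w, …, w + 5`. -/
def searchCmd (a : Bool → ℕ) (f : Bool → Cmd) (w : ℕ) : Cmd :=
  seq (initCmd w) (loop (.lt 6 4) (bodyCmd a f w))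

theorem loopFree_bodyCmd {a : Bool → ℕ} {f : Bool → Cmd} {w : ℕ} (hf : ∀ c, (f c).LoopFree) :
    (bodyCmd a f w).LoopFree := by
  simp [bodyCmd, scanCmd, fetchCmd, nextCmd, visitCmd, block, LoopFree, hf]

/-! ### Effect of the program pieces on registers and arrays -/

section Pieces

variable (a : Bool → ℕ) (w : ℕ) (c : Bool) (s : State)

theorem arr_fetchCmd : ((fetchCmd a w c).run s).arr = s.arr := by
  simp [fetchCmd]

theorem reg_fetchCmd_of_lt {x : ℕ} (hx : x < 7) :
    ((fetchCmd a w c).run s).reg x = s.reg x := by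
  simp [fetchCmd, show x ≠ 7 by omega, show x ≠ 8 by omega, show x ≠ 9 by omega]

theorem reg_fetchCmd_7 :
    ((fetchCmd a w c).run s).reg 7 = s.arr (w + 1) (s.reg (ptr c)) := by
  simp [fetchCmd]

theorem reg_fetchCmd_8 :
    ((fetchCmd a w c).run s).reg 8 = s.arr (posArr w c) (s.arr (w + 1) (s.reg (ptr c))) := by
  simp [fetchCmd]

theorem reg_fetchCmd_9 :
    ((fetchCmd a w c).run s).reg 9 = s.arr (a c) (s.arr (w + 1) (s.reg (ptr c)) + 1) := by
  simp [fetchCmd]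

theorem arr_nextCmd_pos : ((nextCmd a w c).run s).arr (posArr w c) =
    Function.update (s.arr (posArr w c)) (s.reg 7) (s.reg 8 + 1) := by
  simp [nextCmd]

theorem arr_nextCmd_of_ne {b : ℕ} (hb : b ≠ posArr w c) :
    ((nextCmd a w c).run s).arr b = s.arr b := by
  simp [nextCmd, hb]

theorem reg_nextCmd_of_lt {x : ℕ} (hx : x < 8) :
    ((nextCmd a w c).run s).reg x = s.reg x := by
  simp [nextCmd, show x ≠ 10 by omega, show x ≠ 8 by omega]

theorem reg_nextCmd_10 : ((nextCmd a w c).run s).reg 10 = s.arr (a c + 1) (s.reg 8) := by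
  simp [nextCmd]

variable {w}

theorem reg_visitCmd_of_lt {x : ℕ} (hx : x < 7) (h3 : x ≠ 3) (h4 : x ≠ 4) :
    ((visitCmd a w c).run s).reg x = s.reg x := by
  simp [visitCmd, h3, h4, show x ≠ 12 by omega]

theorem reg_visitCmd_3 : ((visitCmd a w c).run s).reg 3 = s.reg 3 + 1 := by
  simp [visitCmd]

theorem reg_visitCmd_4 : ((visitCmd a w c).run s).reg 4 = s.reg 4 + 1 := by
  simp [visitCmd]

theorem arr_visitCmd_visited (hw : 6 ≤ w) :
    ((visitCmd a w c).run s).arr w = Function.update (s.arr w) (s.reg 10) 1 := by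
  obtain ⟨w, rfl⟩ := Nat.exists_eq_add_of_le' hw
  cases c <;> simp [visitCmd, posArr, parArr]

theorem arr_visitCmd_order (hw : 6 ≤ w) :
    ((visitCmd a w c).run s).arr (w + 1) =
      Function.update (s.arr (w + 1)) (s.reg 4) (s.reg 10) := by
  obtain ⟨w, rfl⟩ := Nat.exists_eq_add_of_le' hw
  cases c <;> simp [visitCmd, posArr, parArr]

theorem arr_visitCmd_4 (hw : 6 ≤ w) :
    ((visitCmd a w c).run s).arr 4 = Function.update (s.arr 4) (s.reg 3) (s.reg 7) := by
  obtain ⟨w, rfl⟩ := Nat.exists_eq_add_of_le' hw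
  cases c <;> simp [visitCmd, posArr, parArr]

theorem arr_visitCmd_5 (hw : 6 ≤ w) :
    ((visitCmd a w c).run s).arr 5 = Function.update (s.arr 5) (s.reg 3) (s.reg 10) := by
  obtain ⟨w, rfl⟩ := Nat.exists_eq_add_of_le' hw
  cases c <;> simp [visitCmd, posArr, parArr]

theorem arr_visitCmd_par (hw : 6 ≤ w) :
    ((visitCmd a w c).run s).arr (parArr w c) =
      Function.update (s.arr (parArr w c)) (s.reg 10) (s.reg 7 + 1) := by
  obtain ⟨w, rfl⟩ := Nat.exists_eq_add_of_le' hw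
  cases c <;> simp [visitCmd, posArr, parArr]

theorem arr_visitCmd_par_of_ne (hw : 6 ≤ w) {d : Bool} (hd : d ≠ c) :
    ((visitCmd a w c).run s).arr (parArr w d) = s.arr (parArr w d) := by
  obtain ⟨w, rfl⟩ := Nat.exists_eq_add_of_le' hw
  cases c <;> cases d <;> simp [visitCmd, posArr, parArr] at hd ⊢

theorem arr_visitCmd_pos (hw : 6 ≤ w) (d : Bool) (ha : a d < 4) :
    ((visitCmd a w c).run s).arr (posArr w d) =
      Function.update (s.arr (posArr w d)) (s.reg 10) (s.arr (a d) (s.reg 10)) := by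
  obtain ⟨w, rfl⟩ := Nat.exists_eq_add_of_le' hw
  have h1 : ∀ i, a d ≠ w + 6 + i := by omega
  have h0 : a d ≠ w + 6 := h1 0
  have h5 : a d ≠ 5 := by omega
  cases c <;> cases d <;> simp [visitCmd, posArr, parArr, ha.ne, h0, h1, h5]

theorem arr_visitCmd_of_frame {b : ℕ} (h4 : b ≠ 4) (h5 : b ≠ 5)
    (hb : b < w ∨ w + 6 ≤ b) : ((visitCmd a w c).run s).arr b = s.arr b := by
  have h : ∀ i < 6, b ≠ w + i := by omega
  have h0 : b ≠ w := h 0 (by omega)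
  cases c <;>
  simp [visitCmd, posArr, parArr, h4, h5, h, h0]

end Pieces

end RAM

namespace RAM

open Cmd

/-! ### Simulation of the search by the machine -/

section Simulation

variable {n : ℕ}

/-- The arrays of `s` and `s₀` agree outside the working space and the output of a search. -/
def Frame (w : ℕ) (s₀ s : State) : Prop :=
  ∀ b, b ≠ 4 → b ≠ 5 → (b < w ∨ w + 6 ≤ b) → s.arr b = s₀.arr b

/-- The state `s`, reached from `s₀`, represents the configuration `g`. -/
structure Rel (r : Fin n) (L : Bool → Fin n → List (Fin n)) (w : ℕ) (s₀ : State) (g : Config n)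
    (s : State) : Prop where
  reg_eq : ∀ x < 3, s.reg x = s₀.reg x
  reg_3 : s.reg 3 = g.edges.length
  reg_4 : s.reg 4 = g.edges.length + 1
  reg_ptr : ∀ c, s.reg (ptr c) = g.p c
  frame : Frame w s₀ s
  visited : ∀ v : Fin n, s.arr w v = 0 ↔ v ∉ g.order r
  order : ∀ i ≤ g.edges.length, s.arr (w + 1) i = g.ord r i
  -- Only vertices that the pointer has not passed matter. Positions are absolute indices into the
  -- array of targets.
  pos : ∀ c i, g.p c ≤ i → i ≤ g.edges.length →
    s.arr (posArr w c) (g.ord r i) =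
      offsets (L c) (g.ord r i) + if i = g.p c then g.q c else 0
  par : ∀ c u v, (u, v, c) ∈ g.edges → s.arr (parArr w c) v = u + 1
  par_eq_zero : ∀ c (v : Fin n), (∀ u, (u, v, c) ∉ g.edges) → s.arr (parArr w c) v = 0
  output : ∀ i (h : i < g.edges.length),
    s.arr 4 i = (g.edges[i]).1 ∧ s.arr 5 i = (g.edges[i]).2.1

/-- The adjacency lists of class `c` are stored in arrays `a c` and `a c + 1`. -/
structure Stores (L : Bool → Fin n → List (Fin n)) (a : Bool → ℕ) (s : State) : Prop where
  lt : ∀ c, a c + 1 < 4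
  offsets_eq : ∀ c, s.arr (a c) = offsets (L c)
  targets_eq : ∀ c, s.arr (a c + 1) = targets (L c)

/-- The program `f` decides whether a listed edge belongs to the graph `H`. -/
structure IsFilter (H : SimpleGraph (Fin n)) (L : Fin n → List (Fin n)) (w : ℕ) (s₀ : State)
    (f : Cmd) : Prop where
  loopFree : f.LoopFree
  arr_eq : ∀ s, (f.run s).arr = s.arr
  reg_eq : ∀ s, ∀ x < 11, (f.run s).reg x = s.reg x
  le_one : ∀ s, (f.run s).reg 11 ≤ 1
  iff : ∀ s (u v : Fin n), Frame w s₀ s → s.reg 7 = u → s.reg 10 = v → v ∈ L u →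
    ((f.run s).reg 11 = 1 ↔ H.Adj u v)

theorem ptr_lt (c : Bool) : ptr c < 7 := by cases c <;> simp [ptr]

variable {r : Fin n} {H : Bool → SimpleGraph (Fin n)} {L : Bool → Fin n → List (Fin n)}
  {w : ℕ} {s₀ s : State} {g : Config n} {c : Bool} {a : Bool → ℕ} {f : Bool → Cmd}

/-- With vertex 0 as root, zeroed arrays already hold the right order and list position, since the
first offset is 0; only the visited mark is written. -/
theorem Rel.init (hr : r.val = 0) (hs : ∀ b, w ≤ b → b < w + 6 → s₀.arr b = fun _ => 0) :
    Rel r L w s₀ (Config.init n) ((initCmd w).run s₀) where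
  reg_eq x hx := by
    have h3 : x ≠ 3 := by omega
    have h4 : x ≠ 4 := by omega
    have h5 : x ≠ 5 := by omega
    have h6 : x ≠ 6 := by omega
    have h7 : x ≠ 7 := by omega
    have h8 : x ≠ 8 := by omega
    simp [initCmd, h3, h4, h5, h6, h7, h8]
  reg_3 := by simp [initCmd, Config.init]
  reg_4 := by simp [initCmd, Config.init]
  reg_ptr c := by cases c <;> simp [initCmd, Config.init, ptr]
  frame b _ _ hb := by
    have : b ≠ w := by omega
    simp [initCmd, this]
  visited v := by
    have : v.val = 0 ↔ v = r := by rw [Fin.ext_iff, hr]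
    by_cases hv : v = r
    · simp [initCmd, Config.order, Config.init, hr, hv]
    · simp [initCmd, Config.order, Config.init, hv, this, hs w le_rfl (by omega)]
  order i hi := by
    obtain rfl : i = 0 := by simpa [Config.init] using hi
    simp [initCmd, Config.ord_zero, hr, hs (w + 1) (by omega) (by omega)]
  pos c i _ hi := by
    obtain rfl : i = 0 := by simpa [Config.init] using hi
    have h1 : posArr w c ≠ w := by cases c <;> simp [posArr]
    have h2 : w ≤ posArr w c ∧ posArr w c < w + 6 := by cases c <;> simp [posArr]
    simp [initCmd, Config.ord_zero, hr, h1, hs _ h2.1 h2.2, offsets_zero, Config.init]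
  par c u v h := by simp [Config.init] at h
  par_eq_zero c v _ := by
    have h1 : parArr w c ≠ w := by cases c <;> simp [parArr]
    have h2 : w ≤ parArr w c ∧ parArr w c < w + 6 := by cases c <;> simp [parArr]
    simp [initCmd, h1, hs _ h2.1 h2.2]
  output i h := by simp [Config.init] at h

/-- Registers from `7` on are scratch space. -/
theorem Rel.congr {s' : State} (h : Rel r L w s₀ g s) (harr : s'.arr = s.arr)
    (hreg : ∀ x < 7, s'.reg x = s.reg x) : Rel r L w s₀ g s' where
  reg_eq x hx := (hreg x (by omega)).trans (h.reg_eq x hx)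
  reg_3 := (hreg 3 (by omega)).trans h.reg_3
  reg_4 := (hreg 4 (by omega)).trans h.reg_4
  reg_ptr c := (hreg _ (ptr_lt c)).trans (h.reg_ptr c)
  frame := by unfold Frame; rw [harr]; exact h.frame
  visited := by rw [harr]; exact h.visited
  order := by rw [harr]; exact h.order
  pos := by rw [harr]; exact h.pos
  par := by rw [harr]; exact h.par
  par_eq_zero := by rw [harr]; exact h.par_eq_zero
  output := by rw [harr]; exact h.output

theorem posArr_inj {d : Bool} (h : posArr w d = posArr w c) : d = c := by
  cases c <;> cases d <;> simp [posArr] at h ⊢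

/-- Moving the position in the current list by one. -/
theorem Rel.skip {s' : State} (hw : 6 ≤ w) (hi : g.Inv r H L) (hp : g.p c ≤ g.edges.length)
    (h : Rel r L w s₀ g s)
    (hreg : ∀ x < 7, s'.reg x = s.reg x)
    (hpos : s'.arr (posArr w c) = Function.update (s.arr (posArr w c)) (g.ord r (g.p c))
      (offsets (L c) (g.ord r (g.p c)) + g.q c + 1))
    (harr : ∀ b, b ≠ posArr w c → s'.arr b = s.arr b) : Rel r L w s₀ (g.skip c) s' where
  reg_eq x hx := (hreg x (by omega)).trans (h.reg_eq x hx)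
  reg_3 := (hreg 3 (by omega)).trans h.reg_3
  reg_4 := (hreg 4 (by omega)).trans h.reg_4
  reg_ptr c := (hreg _ (ptr_lt c)).trans (h.reg_ptr c)
  frame b h4 h5 hb := by
    rw [harr b (by cases c <;> simp [posArr] <;> omega)]
    exact h.frame b h4 h5 hb
  visited := by
    rw [harr w (by cases c <;> simp [posArr])]
    exact h.visited
  order := by
    rw [harr (w + 1) (by cases c <;> simp [posArr])]
    exact h.order
  pos d i hd hi' := by
    by_cases hdc : d = c
    · subst hdc
      simp only [Config.skip, Function.update_self]
      change s'.arr (posArr w d) (g.ord r i) = offsets (L d) (g.ord r i) + _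
      rw [hpos]
      by_cases hip : i = g.p d
      · subst hip
        simp [add_assoc]
      · rw [Function.update_of_ne, h.pos d i hd hi', if_neg hip, if_neg hip]
        intro heq
        exact hip (hi.ord_inj hi' hp (Fin.ext heq))
    · rw [harr _ fun heq => hdc (posArr_inj heq)]
      simp only [Config.skip, Function.update_of_ne hdc]
      exact h.pos d i hd hi'
  par d := by
    rw [harr (parArr w d) (by cases c <;> cases d <;> simp [parArr, posArr])]
    exact h.par d
  par_eq_zero d := by
    rw [harr (parArr w d) (by cases c <;> cases d <;> simp [parArr, posArr])]
    exact h.par_eq_zero d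
  output := by
    rw [harr 4 (by cases c <;> simp [posArr] <;> omega),
      harr 5 (by cases c <;> simp [posArr] <;> omega)]
    exact h.output

/-- Moving on to the next vertex. -/
theorem Rel.advance {s' : State} (h : Rel r L w s₀ g s)
    (hreg : ∀ x < 7, x ≠ ptr c → s'.reg x = s.reg x)
    (hptr : s'.reg (ptr c) = s.reg (ptr c) + 1)
    (harr : s'.arr = s.arr) : Rel r L w s₀ (g.advance c) s' where
  reg_eq x hx := (hreg x (by omega) (by cases c <;> simp [ptr] <;> omega)).trans (h.reg_eq x hx)
  reg_3 := (hreg 3 (by omega) (by cases c <;> simp [ptr])).trans h.reg_3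
  reg_4 := (hreg 4 (by omega) (by cases c <;> simp [ptr])).trans h.reg_4
  reg_ptr d := by
    by_cases hdc : d = c
    · subst hdc; simp [Config.advance, hptr, h.reg_ptr]
    · simp only [Config.advance, Function.update_of_ne hdc]
      rw [← h.reg_ptr]
      exact hreg _ (ptr_lt d) (by cases c <;> cases d <;> simp [ptr] at hdc ⊢)
  frame := by unfold Frame; rw [harr]; exact h.frame
  visited := by rw [harr]; exact h.visited
  order := by rw [harr]; exact h.order
  pos d i hd hi := by
    rw [harr]
    by_cases hdc : d = c
    · subst hdc
      simp only [Config.advance, Function.update_self] at hd ⊢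
      have h1 := h.pos d i (by omega) hi
      rw [if_neg (by omega)] at h1
      rw [ite_self]
      exact h1
    · simp only [Config.advance, Function.update_of_ne hdc] at hd ⊢
      exact h.pos d i hd hi
  par := by rw [harr]; exact h.par
  par_eq_zero := by rw [harr]; exact h.par_eq_zero
  output := by rw [harr]; exact h.output

/-- Visiting a vertex. -/
theorem Rel.visit {u v : Fin n} (hw : 6 ≤ w) (hL : Stores L a s₀) (hi : g.Inv r H L)
    (h : Rel r L w s₀ (g.skip c) s) (hp : g.p c ≤ g.edges.length)
    (h7 : s.reg 7 = u) (h10 : s.reg 10 = v) (hv : v ∉ g.order r) :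
    Rel r L w s₀ (g.visit c u v) ((visitCmd a w c).run s) := by
  have hlen : (g.visit c u v).edges.length = g.edges.length + 1 := by simp [Config.visit]
  have h3 : s.reg 3 = g.edges.length := h.reg_3
  have h4 : s.reg 4 = g.edges.length + 1 := h.reg_4
  have hne : ∀ x ∈ g.order r, x.val ≠ v.val := fun x hx heq => hv (Fin.ext heq ▸ hx)
  constructor
  · intro x hx
    rw [reg_visitCmd_of_lt _ _ _ (by omega) (by omega) (by omega), h.reg_eq x hx]
  · rw [reg_visitCmd_3, hlen, h3]
  · rw [reg_visitCmd_4, hlen, h4]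
  · intro d
    rw [reg_visitCmd_of_lt _ _ _ (ptr_lt d) (by cases d <;> simp [ptr])
      (by cases d <;> simp [ptr])]
    exact h.reg_ptr d
  · intro b hb4 hb5 hb
    rw [arr_visitCmd_of_frame _ _ _ hb4 hb5 hb]
    exact h.frame b hb4 hb5 hb
  · intro x
    rw [arr_visitCmd_visited _ _ _ hw, Config.order_visit, h10]
    by_cases hx : x = v
    · simp [hx]
    · rw [Function.update_of_ne (fun heq => hx (Fin.ext heq)), h.visited x]
      simp only [List.mem_append, List.mem_singleton, hx, or_false]
      rfl
  · intro i hi'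
    rw [arr_visitCmd_order _ _ _ hw, h4, h10]
    rw [hlen] at hi'
    by_cases hil : i = g.edges.length + 1
    · subst hil
      rw [Function.update_self, Config.ord_visit_last]
    · rw [Function.update_of_ne hil, Config.ord_visit _ _ (by omega)]
      exact h.order i (by change i ≤ g.edges.length; omega)
  · intro d i hd hi'
    rw [hlen] at hi'
    have hpd := hi.p_le_length d
    have hoff : s.arr (a d) = offsets (L d) := by
      have := hL.lt d
      rw [h.frame (a d) (by omega) (by omega) (by omega), hL.offsets_eq]
    rw [arr_visitCmd_pos _ _ _ hw d (by have := hL.lt d; omega), h10, hoff]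
    by_cases hil : i = g.edges.length + 1
    · subst hil
      rw [Config.ord_visit_last, Function.update_self]
      split_ifs with heq
      · have heq' : g.edges.length + 1 = g.p d := heq
        have hdc : d ≠ c := by rintro rfl; omega
        simp only [Config.visit, Function.update_of_ne hdc]
        rw [hi.q_eq d (by omega), add_zero]
      · rw [add_zero]
    · have hil' : i ≤ g.edges.length := by omega
      rw [Config.ord_visit _ _ hil', Function.update_of_ne (hne _ (Config.ord_mem hil'))]
      exact h.pos d i hd hil'
  · intro d x y hxy
    by_cases hdc : d = c
    · subst hdc
      rw [arr_visitCmd_par _ _ _ hw, h10, h7]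
      simp only [Config.visit, List.mem_append, List.mem_singleton, Prod.mk.injEq] at hxy
      rcases hxy with hxy | ⟨rfl, rfl, -⟩
      · rw [Function.update_of_ne (hne _ ?_)]
        · exact h.par d x y hxy
        · exact List.mem_cons_of_mem _ (List.mem_map.2 ⟨_, hxy, rfl⟩)
      · rw [Function.update_self]
    · rw [arr_visitCmd_par_of_ne _ _ _ hw hdc]
      simp only [Config.visit, List.mem_append, List.mem_singleton, Prod.mk.injEq, hdc, and_false,
        or_false] at hxy
      exact h.par d x y hxy
  · intro d y hy
    simp only [Config.visit, List.mem_append, List.mem_singleton, Prod.mk.injEq, not_or,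
      not_and] at hy
    have h1 := h.par_eq_zero d y fun x => (hy x).1
    by_cases hdc : d = c
    · subst hdc
      rw [arr_visitCmd_par _ _ _ hw, h10, h7, Function.update_of_ne]
      · exact h1
      · exact fun heq => (hy u).2 rfl (Fin.ext heq) rfl
    · rw [arr_visitCmd_par_of_ne _ _ _ hw hdc]
      exact h1
  · intro i hi'
    rw [arr_visitCmd_4 _ _ _ hw, arr_visitCmd_5 _ _ _ hw, h3, h7, h10]
    rw [hlen] at hi'
    by_cases hil : i = g.edges.length
    · subst hil
      simp [Config.visit]
    · have hil' : i < g.edges.length := by omega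
      rw [Function.update_of_ne hil, Function.update_of_ne hil]
      have : s.arr 4 i = (g.edges[i]).1 ∧ s.arr 5 i = (g.edges[i]).2.1 := h.output i hil'
      simpa [Config.visit, List.getElem_append_left hil'] using this

/-- A step of the program is a step of the search. -/
theorem exists_step_scanCmd (hw : 6 ≤ w) (hL : Stores L a s₀)
    (hf : ∀ c, IsFilter (H c) (L c) w s₀ (f c))
    (hmem : ∀ c u v, (H c).Adj u v → v ∈ L c u)
    (hi : g.Inv r H L) (h : Rel r L w s₀ g s)
    (hp : g.p c ≤ g.edges.length) (hc : c = true → g.edges.length < g.p false) :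
    ∃ g', g'.Inv r H L ∧ Rel r L w s₀ g' ((scanCmd a f w c).run s) ∧
      g'.spent r L c = g.spent r L c + 1 ∧ ∀ d ≠ c, g'.spent r L d = g.spent r L d := by
  set u := g.ord r (g.p c) with hu
  set s₁ := (fetchCmd a w c).run s with hs₁
  have harr₁ : s₁.arr = s.arr := arr_fetchCmd ..
  have hreg₁ : ∀ x < 7, s₁.reg x = s.reg x := fun x hx => reg_fetchCmd_of_lt _ _ _ _ hx
  have hord : s.arr (w + 1) (s.reg (ptr c)) = u := by rw [h.reg_ptr, h.order _ hp]
  have h7₁ : s₁.reg 7 = u := by rw [hs₁, reg_fetchCmd_7, hord]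
  have h8₁ : s₁.reg 8 = offsets (L c) u + g.q c := by
    rw [hs₁, reg_fetchCmd_8, hord, h.pos c _ le_rfl hp, if_pos rfl]
  have hlt := hL.lt c
  have h9₁ : s₁.reg 9 = offsets (L c) u + (L c u).length := by
    rw [hs₁, reg_fetchCmd_9, hord, h.frame (a c) (by omega) (by omega) (by omega), hL.offsets_eq,
      offsets_succ]
  have hq := hi.q_le c hp
  have hrun : (scanCmd a f w c).run s = if s₁.reg 8 < s₁.reg 9 then
      (block [nextCmd a w c, f c, load 12 w 10, cond (.lt 12 11) (visitCmd a w c) .skip]).run s₁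
      else (Cmd.succ (ptr c) (ptr c)).run s₁ := rfl
  have h₁ : Rel r L w s₀ g s₁ := h.congr harr₁ hreg₁
  rw [hrun, h8₁, h9₁]
  by_cases hlast : g.q c < (L c u).length
  · rw [if_pos (by omega)]
    set s₂ := (nextCmd a w c).run s₁ with hs₂
    set v := (L c u)[g.q c] with hv
    have h7₂ : s₂.reg 7 = u := by rw [hs₂, reg_nextCmd_of_lt _ _ _ _ (by omega), h7₁]
    have h10₂ : s₂.reg 10 = v := by
      rw [hs₂, reg_nextCmd_10, h8₁, harr₁, h.frame _ (by omega) (by omega) (by omega),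
        hL.targets_eq, targets_offsets_add _ _ _ hlast]
    -- The position is advanced before the edge is judged, so a visit also starts from a state
    -- representing `g.skip c`.
    have h₂ : Rel r L w s₀ (g.skip c) s₂ := by
      refine h₁.skip hw hi hp (fun x hx => reg_nextCmd_of_lt _ _ _ _ (by omega)) ?_
        fun b hb => arr_nextCmd_of_ne _ _ _ _ hb
      rw [hs₂, arr_nextCmd_pos, h7₁, h8₁]
    set s₃ := (load 12 w 10).run ((f c).run s₂) with hs₃
    have harr₃ : s₃.arr = s₂.arr := by simp [hs₃, (hf c).arr_eq]
    have hreg₃ : ∀ x < 11, s₃.reg x = s₂.reg x := fun x hx => by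
      simp [hs₃, (hf c).reg_eq _ x hx, show x ≠ 12 by omega]
    have h₃ : Rel r L w s₀ (g.skip c) s₃ := h₂.congr harr₃ fun x hx => hreg₃ x (by omega)
    have h11 : s₃.reg 11 = ((f c).run s₂).reg 11 := by simp [hs₃]
    have h12 : s₃.reg 12 = s₃.arr w v := by
      rw [harr₃]; simp [hs₃, (hf c).arr_eq, (hf c).reg_eq, h10₂]
    -- As the filter's verdict is at most 1, one comparison says both that the edge is admitted and
    -- that its far end is unvisited.
    have hcond : s₃.reg 12 < s₃.reg 11 ↔ (H c).Adj u v ∧ v ∉ g.order r := by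
      have hle := (hf c).le_one s₂
      have hiff := (hf c).iff s₂ u v h₂.frame h7₂ h10₂ (List.getElem_mem _)
      have hvis : s₃.arr w v = 0 ↔ v ∉ g.order r := h₃.visited v
      rw [← hiff, ← hvis, h12, h11]
      omega
    have hrun₂ : (block [nextCmd a w c, f c, load 12 w 10,
        cond (.lt 12 11) (visitCmd a w c) .skip]).run s₁ =
        if s₃.reg 12 < s₃.reg 11 then (visitCmd a w c).run s₃ else s₃ := rfl
    rw [hrun₂]
    by_cases hnew : (H c).Adj u v ∧ v ∉ g.order r
    · rw [if_pos (hcond.2 hnew)]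
      refine ⟨g.visit c u v, hi.visit hp hc hlast hnew.1 hnew.2,
        h₃.visit hw hL hi hp ((hreg₃ 7 (by omega)).trans h7₂) ((hreg₃ 10 (by omega)).trans h10₂)
          hnew.2, ?_, ?_⟩
      · rw [hi.spent_visit, Config.spent_skip]
      · intro d hd
        rw [hi.spent_visit, Config.spent_skip_of_ne hd]
    · rw [if_neg (fun hlt => hnew (hcond.1 hlt))]
      exact ⟨g.skip c, hi.skip hp hlast (fun hadj => not_not.1 fun hv => hnew ⟨hadj, hv⟩), h₃,
        Config.spent_skip, fun d hd => Config.spent_skip_of_ne hd⟩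
  · rw [if_neg (by omega)]
    have hq' : g.q c = (L c u).length := le_antisymm hq (not_lt.1 hlast)
    refine ⟨g.advance c, hi.advance hmem hp hc hq', h₁.advance ?_ ?_ ?_,
      Config.spent_advance hq', fun d hd => Config.spent_advance_of_ne hd⟩
    · intro x _ hx
      simp [hx]
    · simp
    · simp

/-- The search halts in linear time and finds a priority tree. -/
theorem exec_searchCmd (hr : r.val = 0) (hw : 6 ≤ w)
    (hs : ∀ b, w ≤ b → b < w + 6 → s₀.arr b = fun _ => 0)
    (hL : Stores L a s₀) (hf : ∀ c, IsFilter (H c) (L c) w s₀ (f c))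
    (hmem : ∀ c u v, (H c).Adj u v → v ∈ L c u) :
    ∃ t s g, Exec (searchCmd a f w) s₀ t s ∧ Rel r L w s₀ g s ∧ g.Inv r H L ∧
      g.edges.length < g.p true ∧
      t ≤ ((bodyCmd a f w).size + 1) *
        (∑ v, ((L false v).length + 1) + ∑ v, ((L true v).length + 1)) + 9 := by
  have hfree : (bodyCmd a f w).LoopFree := loopFree_bodyCmd fun c => (hf c).loopFree
  have hfree' : (initCmd w).LoopFree := by simp [initCmd, block, LoopFree]
  obtain ⟨t₁, ht₁, e₁⟩ := exec_run hfree' s₀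
  set M := ∑ v, ((L false v).length + 1) + ∑ v, ((L true v).length + 1) with hM
  obtain ⟨t₂, s, g, e₂, ⟨h, hi⟩, hb, ht₂⟩ := exec_loop hfree (b := .lt 6 4)
    (fun g s => Rel r L w s₀ g s ∧ g.Inv r H L)
    -- Each round adds one to `spent` in one class, and `M` bounds the sum of both.
    (fun g => M - (g.spent r L false + g.spent r L true))
    (fun g s ⟨h, hi⟩ hb => by
      have hb' : s.reg 6 < s.reg 4 := hb
      have h6 : s.reg 6 = g.p true := h.reg_ptr true
      have h5 : s.reg 5 = g.p false := h.reg_ptr false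
      rw [h6, h.reg_4] at hb'
      have hrun : (bodyCmd a f w).run s = if s.reg 5 < s.reg 4 then (scanCmd a f w false).run s
        else (scanCmd a f w true).run s := rfl
      rw [hrun, h5, h.reg_4]
      by_cases hlt : g.p false < g.edges.length + 1
      · rw [if_pos hlt]
        obtain ⟨g', hi', h', hsp, hsp'⟩ := exists_step_scanCmd (c := false) hw hL hf hmem hi h
          (by omega) (by simp)
        refine ⟨g', ⟨h', hi'⟩, ?_⟩
        have h1 := hi'.spent_le false
        have h2 := hi'.spent_le true
        have h3 := hsp' true (by simp)
        omega
      · rw [if_neg hlt]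
        obtain ⟨g', hi', h', hsp, hsp'⟩ := exists_step_scanCmd (c := true) hw hL hf hmem hi h
          (by omega) (fun _ => by omega)
        refine ⟨g', ⟨h', hi'⟩, ?_⟩
        have h1 := hi'.spent_le false
        have h2 := hi'.spent_le true
        have h3 := hsp' false (by simp)
        omega)
    (Config.init n) _ ⟨Rel.init hr hs, Config.inv_init r⟩
  refine ⟨_, s, g, .seq e₁ e₂, h, hi, ?_, ?_⟩
  · have hb' : ¬ s.reg 6 < s.reg 4 := hb
    have h6 : s.reg 6 = g.p true := h.reg_ptr true
    rw [h6, h.reg_4] at hb'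
    omega
  -- The 9 consists of these 8 steps and the last test of the loop.
  · have hsize : (initCmd w).size = 8 := by simp [initCmd, block, size]
    have hle := Nat.mul_le_mul_left ((bodyCmd a f w).size + 1) (Nat.sub_le M
      ((Config.init n).spent r L false + (Config.init n).spent r L true))
    omega

theorem Rel.outputs (h : Rel r L w s₀ g s) (hi : g.Inv r H L) :
    Outputs s (g.tree false ⊔ g.tree true) := by
  have hmap : (g.edges.map fun e => (e.1, e.2.1)).map (fun e => s(e.1, e.2)) =
      g.edges.map fun e => s(e.1, e.2.1) := by
    rw [List.map_map]; rfl
  refine ⟨g.edges.map fun e => (e.1, e.2.1), ?_, ?_, ?_, ?_⟩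
  · rw [List.length_map, h.reg_3]
  · intro j hj
    rw [List.length_map] at hj
    simpa using h.output j hj
  · rw [hmap]; exact hi.nodup_edges
  · intro e
    rw [hmap]; exact hi.mem_edgeSet_iff e

end Simulation

end RAM

namespace RAM

open Cmd

/-! ### Trees in parent arrays -/

/-- The graph with an edge from `v` to `α v - 1` whenever `α v ≠ 0`. -/
def parGraph (n : ℕ) (α : ℕ → ℕ) : SimpleGraph (Fin n) :=
  SimpleGraph.fromRel fun u v => α v = u + 1

/-- The array `α` lists each edge of `parGraph n α` exactly once. -/
structure IsParArray (n : ℕ) (α : ℕ → ℕ) : Prop where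
  exists_eq : ∀ v : Fin n, α v ≠ 0 → ∃ u : Fin n, α v = u + 1
  -- Excludes loops (`u = v`) and edges stored at both ends, so nonzero cells can be counted as
  -- edges.
  asymm : ∀ u v : Fin n, α v = u + 1 → α u ≠ v + 1

section ParGraph

variable {n : ℕ} {α β γ : ℕ → ℕ}

theorem IsParArray.mono (hα : IsParArray n α) (h : ∀ v : Fin n, γ v ≠ 0 → γ v = α v) :
    IsParArray n γ where
  exists_eq v hv := by
    rw [h v hv]
    exact hα.exists_eq v (h v hv ▸ hv)
  asymm u v hv hu := by
    rw [h v (by omega)] at hv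
    rw [h u (by omega)] at hu
    exact hα.asymm u v hv hu

theorem parGraph_mono (h : ∀ v : Fin n, γ v ≠ 0 → γ v = α v) : parGraph n γ ≤ parGraph n α := by
  intro u v huv
  rw [parGraph, SimpleGraph.fromRel_adj] at huv ⊢
  refine ⟨huv.1, huv.2.imp (fun h' => ?_) (fun h' => ?_)⟩
  · rwa [← h v (by omega)]
  · rwa [← h u (by omega)]

theorem IsParArray.adj (hα : IsParArray n α) {u v : Fin n} :
    (parGraph n α).Adj u v ↔ α v = u + 1 ∨ α u = v + 1 := by
  rw [parGraph, SimpleGraph.fromRel_adj, and_iff_right_iff_imp]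
  rintro (h | h) rfl <;> exact hα.asymm _ _ h h

/-- Sending a nonzero cell to the edge it stores is injective by `asymm`. This lets the machine
count edges by counting cells. -/
theorem IsParArray.ncard_edgeSet (hα : IsParArray n α) :
    (parGraph n α).edgeSet.ncard = (Finset.univ.filter fun v : Fin n => α v ≠ 0).card := by
  choose! p hp using hα.exists_eq
  have himage : (parGraph n α).edgeSet =
      (fun v => s(p v, v)) '' ↑(Finset.univ.filter fun v : Fin n => α v ≠ 0) := by
    ext e
    induction e with
    | _ x y =>
      simp only [SimpleGraph.mem_edgeSet, hα.adj, Finset.coe_filter, Finset.mem_univ, true_and,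
        Set.mem_image, Set.mem_ofPred_eq]
      have key : ∀ {x y : Fin n}, α y = x + 1 → p y = x := fun {x y} h => by
        have := hp y (by omega)
        exact Fin.ext (by omega)
      constructor
      · rintro (h | h)
        · exact ⟨y, by omega, by rw [key h]⟩
        · exact ⟨x, by omega, by rw [key h, Sym2.eq_swap]⟩
      · rintro ⟨v, hv, heq⟩
        rcases Sym2.eq_iff.1 heq with ⟨rfl, rfl⟩ | ⟨rfl, rfl⟩
        · exact Or.inl (hp _ hv)
        · exact Or.inr (hp _ hv)
  rw [himage, Set.InjOn.ncard_image, Set.ncard_coe_finset]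
  intro v hv w hw heq
  simp only [Finset.coe_filter, Finset.mem_univ, true_and, Set.mem_ofPred_eq] at hv hw
  rcases Sym2.eq_iff.1 heq with ⟨-, h⟩ | ⟨h1, h2⟩
  · exact h
  · have h3 := hp v hv
    have h4 := hp w hw
    rw [h1] at h3
    rw [← h2] at h4
    exact absurd h4 (hα.asymm _ _ h3)

variable {r : Fin n} {H : Bool → SimpleGraph (Fin n)} {L : Bool → Fin n → List (Fin n)}
  {w : ℕ} {s₀ s : State} {g : Config n}

theorem Rel.par_iff (h : Rel r L w s₀ g s) (c : Bool) (u v : Fin n) :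
    s.arr (parArr w c) v = u + 1 ↔ (u, v, c) ∈ g.edges := by
  refine ⟨fun huv => ?_, h.par c u v⟩
  by_contra hnot
  by_cases hex : ∃ u', (u', v, c) ∈ g.edges
  · obtain ⟨u', hu'⟩ := hex
    have h1 := h.par c u' v hu'
    obtain rfl : u = u' := Fin.ext (by omega)
    exact hnot hu'
  · have h1 := h.par_eq_zero c v fun u' hu' => hex ⟨u', hu'⟩
    omega

theorem Rel.tree_eq (h : Rel r L w s₀ g s) (c : Bool) :
    g.tree c = parGraph n (s.arr (parArr w c)) := by
  ext u v
  simp only [Config.tree, parGraph, SimpleGraph.fromRel_adj, h.par_iff]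

/-- An edge stored at both ends would occur twice in the duplicate-free edge list of the search. -/
theorem Rel.isParArray (h : Rel r L w s₀ g s) (hi : g.Inv r H L) (c : Bool) :
    IsParArray n (s.arr (parArr w c)) where
  exists_eq v hv := by
    by_contra hnot
    refine hv (h.par_eq_zero c v fun u hu => hnot ⟨u, h.par c u v hu⟩)
  asymm u v huv hvu := by
    rw [h.par_iff] at huv hvu
    have h1 := List.inj_on_of_nodup_map hi.nodup_edges huv hvu Sym2.eq_swap
    exact (hi.valid _ _ _ huv).1.ne (Prod.ext_iff.1 h1).1

end ParGraph

/-! ### Filters -/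

/-- Use every edge. -/
def allCmd : Cmd := const 11 1

/-- Use the edges of the graph in the parent array `b`. -/
def parCmd (b : ℕ) : Cmd :=
  block [load 12 b 7, succ 13 10, cond (.eq 12 13) (const 11 1)
    (block [load 12 b 10, succ 13 7, cond (.eq 12 13) (const 11 1) (const 11 0)])]

section Filters

variable {n w b : ℕ} {H : SimpleGraph (Fin n)} {L : Fin n → List (Fin n)} {s₀ : State}

theorem isFilter_allCmd (h : ∀ u v, v ∈ L u → H.Adj u v) : IsFilter H L w s₀ allCmd where
  loopFree := trivial
  arr_eq s := rfl
  reg_eq s x hx := by simp [allCmd, show x ≠ 11 by omega]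
  le_one s := by simp [allCmd]
  iff s u v _ _ _ hv := by simp [allCmd, h u v hv]

/-- An edge may be stored at either end, so two cells decide adjacency in constant time. -/
theorem isFilter_parCmd (hb : b < w) (hb4 : b ≠ 4) (hb5 : b ≠ 5)
    (hα : IsParArray n (s₀.arr b)) :
    IsFilter (parGraph n (s₀.arr b)) L w s₀ (parCmd b) where
  loopFree := by simp [parCmd, block, LoopFree]
  arr_eq s := by simp only [parCmd, run_block_cons, run_cond_eq]; split_ifs <;> simp
  reg_eq s x hx := by
    simp only [parCmd, run_block_cons, run_cond_eq]
    have h11 : x ≠ 11 := by omega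
    have h12 : x ≠ 12 := by omega
    have h13 : x ≠ 13 := by omega
    split_ifs <;> simp [h11, h12, h13]
  le_one s := by simp only [parCmd, run_block_cons, run_cond_eq]; split_ifs <;> simp
  iff s u v hs hu hv _ := by
    have harr := hs b hb4 hb5 (Or.inl hb)
    rw [hα.adj]
    simp only [parCmd, run_block_cons, run_cond_eq, run_block_nil]
    simp only [run_load, run_succ, State.reg_setReg, State.arr_setReg, hu, hv, harr, run_const]
    by_cases h1 : s₀.arr b u = v + 1 <;> by_cases h2 : s₀.arr b v = u + 1 <;> simp [h1, h2]

end Filters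

/-! ### Selection of red edges -/

/-- Select the edge of the vertex in register `5`. -/
def selectCmd : Cmd := block [store 18 5 6, succ 4 4]

/-- Select the edge in cell `reg 5` of parent array `10` if it is in the graph in array `17`. -/
def keepCmd : Cmd :=
  block [load 6 10 5, const 7 0,
    cond (.lt 7 6)
      (block [pred 8 6, load 9 17 5, load 10 17 8, succ 11 5,
        cond (.eq 9 6) selectCmd (cond (.eq 10 11) selectCmd skip)])
      skip,
    succ 5 5]

/-- Select the edge in cell `reg 5` of parent array `10` if more edges are needed. -/
def fillCmd : Cmd :=
  block [cond (.lt 4 1) (block [load 6 10 5, load 7 18 5, cond (.lt 7 6) selectCmd skip]) skip,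
    succ 5 5]

/-- Copy from the parent array `10` to the parent array `18` the edges of the graph in the parent
array `17`, and then further edges until there are `reg 1`, and count them in register `4`. -/
def chooseCmd : Cmd :=
  block [const 4 0, const 5 0, loop (.lt 5 0) keepCmd, const 5 0, loop (.lt 5 0) fillCmd]

/-- The edge in cell `v` of the parent array `α` is an edge of the graph in `β`. -/
def Kept (α β : ℕ → ℕ) (v : ℕ) : Prop :=
  α v ≠ 0 ∧ (β v = α v ∨ β (α v - 1) = v + 1)

section Selection

variable {n : ℕ}

/-- The number of edges in a parent array. -/
def parCount (n : ℕ) (α : ℕ → ℕ) : ℕ :=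
  (Finset.univ.filter fun v : Fin n => α v ≠ 0).card

theorem parCount_update {γ : ℕ → ℕ} {i x : ℕ} (hi : i < n) (h0 : γ i = 0) (hx : x ≠ 0) :
    parCount n (Function.update γ i x) = parCount n γ + 1 := by
  have : (Finset.univ.filter fun v : Fin n => Function.update γ i x v ≠ 0) =
      insert ⟨i, hi⟩ (Finset.univ.filter fun v : Fin n => γ v ≠ 0) := by
    ext v
    by_cases hv : v.val = i
    · have : v = ⟨i, hi⟩ := Fin.ext hv
      simp [this, hx]
    · simp [hv, Fin.ext_iff]
  rw [parCount, this, Finset.card_insert_of_notMem (by simp [h0])]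
  rfl

/-- Registers `0`, `1`, `2` and all arrays but array `18` agree. -/
def SelectFrame (s₀ s : State) : Prop :=
  (∀ x < 3, s.reg x = s₀.reg x) ∧ ∀ b, b ≠ 18 → s.arr b = s₀.arr b

open Classical in
/-- Invariant of the loop over `keepCmd`. -/
structure KeepInv (n : ℕ) (s₀ : State) (i : ℕ) (s : State) : Prop where
  frame : SelectFrame s₀ s
  reg_5 : s.reg 5 = i
  reg_4 : s.reg 4 = parCount n (s.arr 18)
  arr_18 : ∀ v, s.arr 18 v = if v < i ∧ Kept (s₀.arr 10) (s₀.arr 17) v then s₀.arr 10 v else 0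

/-- Invariant of the loop over `fillCmd`. -/
structure FillInv (n : ℕ) (s₀ : State) (i : ℕ) (s : State) : Prop where
  frame : SelectFrame s₀ s
  reg_5 : s.reg 5 = i
  reg_4 : s.reg 4 = parCount n (s.arr 18)
  arr_18 : ∀ v, s.arr 18 v ≠ 0 → s.arr 18 v = s₀.arr 10 v
  kept : ∀ v < n, Kept (s₀.arr 10) (s₀.arr 17) v → s.arr 18 v = s₀.arr 10 v
  -- An edge is passed over only once `k` edges are selected; so if fewer than `k` are found, all
  -- were taken.
  le : ∀ v < i, s.arr 18 v = 0 → s₀.arr 10 v ≠ 0 → s₀.reg 1 ≤ s.reg 4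
  -- Filling never overshoots; so if more than `k` are found, all of them are compulsory.
  ge : s₀.reg 1 < s.reg 4 → ∀ v < n, s.arr 18 v ≠ 0 → Kept (s₀.arr 10) (s₀.arr 17) v

variable {s₀ s : State} {i : ℕ}

theorem KeepInv.step (h : KeepInv n s₀ i s) (hi : i < n) :
    KeepInv n s₀ (i + 1) (keepCmd.run s) := by
  obtain ⟨⟨hreg, harr⟩, h5, h4, h18⟩ := h
  have h10 := harr 10 (by omega)
  have h17 := harr 17 (by omega)
  by_cases hk : Kept (s₀.arr 10) (s₀.arr 17) i
  · have hrun : (keepCmd.run s).reg 4 = s.reg 4 + 1 ∧ (keepCmd.run s).reg 5 = i + 1 ∧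
        (∀ x < 3, (keepCmd.run s).reg x = s.reg x) ∧
        (∀ b, b ≠ 18 → (keepCmd.run s).arr b = s.arr b) ∧
        (keepCmd.run s).arr 18 = Function.update (s.arr 18) i (s₀.arr 10 i) := by
      obtain ⟨h0, hk⟩ := hk
      have hx : ∀ x < 3, x ≠ 4 ∧ x ≠ 5 ∧ x ≠ 6 ∧ x ≠ 7 ∧ x ≠ 8 ∧ x ≠ 9 ∧ x ≠ 10 ∧ x ≠ 11 := by
        omega
      have hpos := Nat.pos_of_ne_zero h0
      by_cases hl : s₀.arr 17 i = s₀.arr 10 i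
      · refine ⟨?_, ?_, fun x h3 => ?_, fun b hb => ?_, ?_⟩ <;>
          simp +contextual [keepCmd, selectCmd, *]
      · have hr := hk.resolve_left hl
        refine ⟨?_, ?_, fun x h3 => ?_, fun b hb => ?_, ?_⟩ <;>
          simp +contextual [keepCmd, selectCmd, *]
    obtain ⟨e4, e5, ereg, earr, e18⟩ := hrun
    refine ⟨⟨fun x hx => (ereg x hx).trans (hreg x hx), fun b hb => (earr b hb).trans (harr b hb)⟩,
      e5, ?_, ?_⟩
    · rw [e4, e18, h4, parCount_update hi _ hk.1]
      rw [h18 i, if_neg (by omega)]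
    · intro v
      rw [e18]
      by_cases hv : v = i
      · subst hv
        rw [Function.update_self, if_pos ⟨by omega, hk⟩]
      · rw [Function.update_of_ne hv, h18 v]
        congr 1
        rw [eq_iff_iff]
        have : v < i ↔ v < i + 1 := by omega
        rw [this]
  · have hrun : (keepCmd.run s).reg 4 = s.reg 4 ∧ (keepCmd.run s).reg 5 = i + 1 ∧
        (∀ x < 3, (keepCmd.run s).reg x = s.reg x) ∧ (keepCmd.run s).arr = s.arr := by
      have hx : ∀ x < 3, x ≠ 4 ∧ x ≠ 5 ∧ x ≠ 6 ∧ x ≠ 7 ∧ x ≠ 8 ∧ x ≠ 9 ∧ x ≠ 10 ∧ x ≠ 11 := by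
        omega
      rcases Nat.eq_zero_or_pos (s₀.arr 10 i) with h0 | hpos
      · refine ⟨?_, ?_, fun x h3 => ?_, ?_⟩ <;>
          simp +contextual [keepCmd, selectCmd, *]
      · have hl : s₀.arr 17 i ≠ s₀.arr 10 i := fun h => hk ⟨hpos.ne', Or.inl h⟩
        have hr : s₀.arr 17 (s₀.arr 10 i - 1) ≠ i + 1 := fun h => hk ⟨hpos.ne', Or.inr h⟩
        refine ⟨?_, ?_, fun x h3 => ?_, ?_⟩ <;>
          simp +contextual [keepCmd, selectCmd, *]
    obtain ⟨e4, e5, ereg, earr⟩ := hrun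
    refine ⟨⟨fun x hx => (ereg x hx).trans (hreg x hx), fun b hb => ?_⟩, e5, ?_, ?_⟩
    · rw [earr]; exact harr b hb
    · rw [e4, earr, h4]
    · intro v
      rw [earr, h18 v]
      congr 1
      rw [eq_iff_iff]
      refine and_congr_left fun hkv => ?_
      have : v ≠ i := by rintro rfl; exact hk hkv
      omega

theorem FillInv.step (h : FillInv n s₀ i s) (hi : i < n) :
    FillInv n s₀ (i + 1) (fillCmd.run s) := by
  obtain ⟨⟨hreg, harr⟩, h5, h4, h18, hkept, hle, hge⟩ := h
  have h10 := harr 10 (by omega)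
  have h1 := hreg 1 (by omega)
  -- A cell of array `18` is zero or equal to that of array `10`, so the strict inequality means
  -- that there is an edge and that it is unselected.
  by_cases hk : s.reg 4 < s₀.reg 1 ∧ s.arr 18 i < s₀.arr 10 i
  · have hrun : (fillCmd.run s).reg 4 = s.reg 4 + 1 ∧ (fillCmd.run s).reg 5 = i + 1 ∧
        (∀ x < 3, (fillCmd.run s).reg x = s.reg x) ∧
        (∀ b, b ≠ 18 → (fillCmd.run s).arr b = s.arr b) ∧
        (fillCmd.run s).arr 18 = Function.update (s.arr 18) i (s₀.arr 10 i) := by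
      clear h4
      have hx : ∀ x < 3, x ≠ 4 ∧ x ≠ 5 ∧ x ≠ 6 ∧ x ≠ 7 := by
        omega
      refine ⟨?_, ?_, fun x h3 => ?_, fun b hb => ?_, ?_⟩ <;>
        simp [fillCmd, selectCmd, *]
    obtain ⟨e4, e5, ereg, earr, e18⟩ := hrun
    have h0 : s.arr 18 i = 0 := by
      by_contra hne
      have := h18 i hne
      omega
    refine ⟨⟨fun x hx => (ereg x hx).trans (hreg x hx), fun b hb => (earr b hb).trans (harr b hb)⟩,
      e5, ?_, ?_, ?_, ?_, ?_⟩
    · rw [e4, e18, h4, parCount_update hi h0 (by omega)]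
    · intro v
      rw [e18]
      by_cases hv : v = i
      · subst hv; simp
      · rw [Function.update_of_ne hv]; exact h18 v
    · intro v hv
      rw [e18]
      by_cases hvi : v = i
      · subst hvi; simp
      · rw [Function.update_of_ne hvi]; exact hkept v hv
    · intro v hv
      rw [e18]
      by_cases hvi : v = i
      · subst hvi
        rw [Function.update_self]
        intro h h'
        exact absurd h h'
      · rw [Function.update_of_ne hvi, e4]
        intro h h'
        exact (hle v (by omega) h h').trans (Nat.le_succ _)
    · intro hlt
      omega
  · have hrun : (fillCmd.run s).reg 4 = s.reg 4 ∧ (fillCmd.run s).reg 5 = i + 1 ∧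
        (∀ x < 3, (fillCmd.run s).reg x = s.reg x) ∧ (fillCmd.run s).arr = s.arr := by
      clear h4
      have hx : ∀ x < 3, x ≠ 4 ∧ x ≠ 5 ∧ x ≠ 6 ∧ x ≠ 7 := by
        omega
      by_cases hl : s.reg 4 < s₀.reg 1
      · have hr : ¬ s.arr 18 i < s₀.arr 10 i := fun h => hk ⟨hl, h⟩
        refine ⟨?_, ?_, fun x h3 => ?_, ?_⟩ <;>
          simp [fillCmd, selectCmd, *]
      · refine ⟨?_, ?_, fun x h3 => ?_, ?_⟩ <;>
          simp [fillCmd, selectCmd, *]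
    obtain ⟨e4, e5, ereg, earr⟩ := hrun
    refine ⟨⟨fun x hx => (ereg x hx).trans (hreg x hx), fun b hb => ?_⟩, e5, ?_, ?_, ?_, ?_, ?_⟩
    · rw [earr]; exact harr b hb
    · rw [e4, earr, h4]
    · rw [earr]; exact h18
    · rw [earr]; exact hkept
    · rw [earr, e4]
      intro v hv h h'
      by_cases hvi : v = i
      · subst hvi
        by_contra hlt
        exact hk ⟨by omega, by omega⟩
      · exact hle v (by omega) h h'
    · rw [earr, e4]; exact hge

/-- Selecting edges takes linear time. -/
theorem exec_chooseCmd (h0 : s₀.reg 0 = n) (h18 : s₀.arr 18 = fun _ => 0) :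
    ∃ t s, Exec chooseCmd s₀ t s ∧ FillInv n s₀ n s ∧
      t ≤ (keepCmd.size + fillCmd.size + 2) * n + 6 := by
  have hkf : keepCmd.LoopFree := by simp [keepCmd, selectCmd, block, LoopFree]
  have hff : fillCmd.LoopFree :=
    ⟨⟨⟨trivial, trivial, ⟨⟨trivial, trivial, trivial⟩, trivial⟩, trivial⟩, trivial⟩, trivial,
      trivial⟩
  obtain ⟨t₁, s₁, e₁, h₁, ht₁⟩ := exec_count (x := 5) (y := 0) (n := n) hkf (KeepInv n s₀)
    (fun _ _ h => h.reg_5) (fun _ _ h => (h.frame.1 0 (by omega)).trans h0)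
    (fun _ _ h hi => h.step hi) ((s₀.setReg 4 0).setReg 5 0)
    ⟨⟨fun x hx => by simp [show x ≠ 4 by omega, show x ≠ 5 by omega], fun b _ => rfl⟩,
      by simp, by simp [h18, parCount], by simp [h18]⟩
  obtain ⟨t₂, s₂, e₂, h₂, ht₂⟩ := exec_count (x := 5) (y := 0) (n := n) hff (FillInv n s₀)
    (fun _ _ h => h.reg_5) (fun _ _ h => (h.frame.1 0 (by omega)).trans h0)
    (fun _ _ h hi => h.step hi) (s₁.setReg 5 0)
    { frame := ⟨fun x hx => by simp [show x ≠ 5 by omega, h₁.frame.1 x hx],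
        fun b hb => h₁.frame.2 b hb⟩
      reg_5 := by simp
      reg_4 := by simp [h₁.reg_4]
      arr_18 := fun v hv => by
        rw [State.arr_setReg, h₁.arr_18] at hv ⊢
        split_ifs at hv ⊢ with h
        · rfl
        · exact absurd rfl hv
      kept := fun v hv hk => by rw [State.arr_setReg, h₁.arr_18, if_pos ⟨hv, hk⟩]
      le := fun v hv => absurd hv (Nat.not_lt_zero v)
      ge := fun _ v _ hv => by
        rw [State.arr_setReg, h₁.arr_18] at hv
        by_contra hk
        exact hv (if_neg fun h => hk h.2) }
  refine ⟨_, s₂, .seq (.const _ _ _) (.seq (.const _ _ _) (.seq e₁ (.seq (.const _ _ _)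
    (.seq e₂ (.skip _))))), h₂, ?_⟩
  -- The other six steps are four single commands and the last tests of the two loops.
  have : (keepCmd.size + fillCmd.size + 2) * n =
    (keepCmd.size + 1) * n + (fillCmd.size + 1) * n := by ring
  omega

end Selection

end RAM

namespace RAM

open Cmd

/-! ### Input and running time -/

section Input

variable {n : ℕ}

theorem IsAdjLists.sum_length_le {G : SimpleGraph (Fin n)} {E : Set (Sym2 (Fin n))}
    {L : Fin n → List (Fin n)} (hL : IsAdjLists E L) (hE : E ⊆ G.edgeSet) :
    ∑ v, (L v).length ≤ 2 * G.edgeSet.ncard := by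
  classical
  rw [← SimpleGraph.coe_edgeFinset, Set.ncard_coe_finset, ← G.sum_degrees_eq_twice_card_edges]
  refine Finset.sum_le_sum fun v _ => ?_
  rw [← List.toFinset_card_of_nodup (hL v).1, ← SimpleGraph.card_neighborFinset_eq_degree]
  refine Finset.card_le_card fun u hu => ?_
  rw [SimpleGraph.mem_neighborFinset]
  exact hE (((hL v).2 u).1 (List.mem_toFinset.1 hu))

/-- The arrays with the lists of the first family in class `false`. -/
def arraysFst (c : Bool) : ℕ := bif c then 2 else 0

/-- The arrays with the lists of the second family in class `false`. -/
def arraysSnd (c : Bool) : ℕ := bif c then 0 else 2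

variable {k : ℕ} {L₀ L₁ : Fin n → List (Fin n)} {s : State}

theorem stores_fst (h : ∀ b < 4, s.arr b = (input n k L₀ L₁).arr b) :
    Stores (fun c => bif c then L₁ else L₀) arraysFst s where
  lt c := by cases c <;> simp [arraysFst]
  offsets_eq c := by cases c <;> exact h _ (by simp [arraysFst])
  targets_eq c := by cases c <;> exact h _ (by simp [arraysFst])

theorem stores_snd (h : ∀ b < 4, s.arr b = (input n k L₀ L₁).arr b) :
    Stores (fun c => bif c then L₀ else L₁) arraysSnd s where
  lt c := by cases c <;> simp [arraysSnd]
  offsets_eq c := by cases c <;> exact h _ (by simp [arraysSnd])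
  targets_eq c := by cases c <;> exact h _ (by simp [arraysSnd])

/-- The priority search on a connected graph, with the time bound in terms of its size. -/
theorem exists_exec_searchCmd (a : Bool → ℕ) (f : Bool → Cmd) (w : ℕ) (hw : 6 ≤ w) :
    ∃ C, ∀ {n : ℕ} {G : SimpleGraph (Fin n)} {E : Bool → Set (Sym2 (Fin n))}
      {H : Bool → SimpleGraph (Fin n)} {L : Bool → Fin n → List (Fin n)} {r : Fin n} {s₀ : State},
      G.Connected → (∀ c, E c ⊆ G.edgeSet) → (∀ c, IsAdjLists (E c) (L c)) →
      (∀ c, (H c).edgeSet ⊆ E c) → (H false ⊔ H true).Connected → r.val = 0 →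
      (∀ b, w ≤ b → s₀.arr b = fun _ => 0) → Stores L a s₀ →
      (∀ c, IsFilter (H c) (L c) w s₀ (f c)) →
      ∃ t s g, Exec (searchCmd a f w) s₀ t s ∧ Rel r L w s₀ g s ∧ g.Inv r H L ∧
        IsPriorityTree (H false) (H true) (g.tree false) (g.tree true) ∧
        t ≤ C * (G.edgeSet.ncard + 1) := by
  -- Each family of lists has total length at most `2m`, and `n ≤ m + 1`, so `4m + 2n ≤ 6(m + 1)`.
  -- Edges rejected by the filter are paid for too, hence the sets `E c` besides the graphs `H c`.
  refine ⟨((bodyCmd a f w).size + 1) * 6 + 9, ?_⟩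
  intro n G E H L r s₀ hG hE hadj hHE hH hr hs hL hf
  obtain ⟨t, s, g, e, h, hi, hp, ht⟩ := exec_searchCmd hr hw (fun b hb _ => hs b hb) hL hf
    (fun c u v huv => ((hadj c u).2 v).2 (hHE c huv))
  refine ⟨t, s, g, e, h, hi, hi.isPriorityTree hH hp, ht.trans ?_⟩
  generalize (bodyCmd a f w).size + 1 = K
  have h1 := hG.card_vert_le_card_edgeSet_add_one
  rw [Nat.card_coe_set_eq, Nat.card_eq_fintype_card, Fintype.card_fin] at h1
  have h2 := (hadj false).sum_length_le (hE false)
  have h3 := (hadj true).sum_length_le (hE true)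
  have h4 : ∑ v, ((L false v).length + 1) + ∑ v, ((L true v).length + 1) ≤
      6 * (G.edgeSet.ncard + 1) := by
    simp only [Finset.sum_add_distrib, Finset.sum_const, Finset.card_univ, Fintype.card_fin,
      smul_eq_mul, mul_one]
    omega
  have h5 := Nat.mul_le_mul_left K h4
  rw [← mul_assoc] at h5
  rw [add_mul]
  omega

end Input

/-! ### The choice of the red edges -/

/-- The two searches may orient a common edge differently, which accounts for the two alternatives
in `Kept`. -/
theorem kept_iff {n : ℕ} {α β : ℕ → ℕ} (hβ : IsParArray n β) {u v : Fin n} (h : α v = u + 1) :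
    Kept α β v ↔ (parGraph n β).Adj u v := by
  rw [hβ.adj, Kept, h]
  simp

/-- The graph in array `18` after the selection. -/
theorem FillInv.parGraph_bounds {n : ℕ} {s₀ s : State} (h : FillInv n s₀ n s)
    (hα : IsParArray n (s₀.arr 10)) (hβ : IsParArray n (s₀.arr 17))
    (hle : parGraph n (s₀.arr 17) ≤ parGraph n (s₀.arr 10)) :
    IsParArray n (s.arr 18) ∧ parGraph n (s₀.arr 17) ≤ parGraph n (s.arr 18) ∧
      parGraph n (s.arr 18) ≤ parGraph n (s₀.arr 10) ∧
      s.reg 4 = (parGraph n (s.arr 18)).edgeSet.ncard ∧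
      (s₀.reg 1 < s.reg 4 → parGraph n (s.arr 18) ≤ parGraph n (s₀.arr 17)) ∧
      (s.reg 4 < s₀.reg 1 → parGraph n (s₀.arr 10) ≤ parGraph n (s.arr 18)) := by
  have hγ : IsParArray n (s.arr 18) := hα.mono fun v => h.arr_18 v
  refine ⟨hγ, ?_, parGraph_mono fun v => h.arr_18 v, ?_, ?_, ?_⟩
  · have key : ∀ u v : Fin n, s₀.arr 10 v = u + 1 → (parGraph n (s₀.arr 17)).Adj u v →
        s.arr 18 v = u + 1 := fun u v huv hadj => by
      rw [h.kept v v.2 ((kept_iff hβ huv).2 hadj), huv]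
    intro u v huv
    rw [hγ.adj]
    exact (hα.adj.1 (hle huv)).imp (fun h => key u v h huv) fun h => key v u h huv.symm
  · rw [hγ.ncard_edgeSet, h.reg_4]
    rfl
  · intro hlt u v huv
    have key : ∀ u v : Fin n, s.arr 18 v = u + 1 → (parGraph n (s₀.arr 17)).Adj u v :=
      fun u v huv => (kept_iff hβ (by rw [← h.arr_18 v (by omega), huv])).1
        (h.ge hlt v v.2 (by omega))
    rcases hγ.adj.1 huv with h' | h'
    · exact key u v h'
    · exact (key v u h').symm
  · intro hlt
    refine parGraph_mono fun v hv => (h.arr_18 v fun h0 => ?_).symm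
    have := h.le v v.2 h0 hv
    omega

/-! ### The programs -/

/-- Find a spanning tree with exactly `reg 1` edges of the first class. -/
def redTreeCmd : Cmd :=
  -- Nothing is cleared in the working space, so the searches use separate zero arrays `6–11`,
  -- `12–17` and `19–24`. Array `10 = 6 + 4` holds the forest `A₀`, array `17 = 12 + 5` the red part
  -- `B₁`, and array `18` the selection `R`.
  block [searchCmd arraysFst (fun _ => allCmd) 6,
    searchCmd arraysSnd (fun c => bif c then parCmd 10 else allCmd) 12,
    chooseCmd,
    cond (.eq 4 1)
      (seq (const 2 1) (searchCmd arraysFst (fun c => bif c then allCmd else parCmd 18) 19))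
      skip]

theorem exists_redTreeCmd :
    ∃ C : ℕ, ∀ (n k : ℕ) (G : SimpleGraph (Fin n)) (Er Eb : Set (Sym2 (Fin n)))
      (redAdj blueAdj : Fin n → List (Fin n)),
      G.Connected → Er ∪ Eb = G.edgeSet → Disjoint Er Eb →
      IsAdjLists Er redAdj → IsAdjLists Eb blueAdj →
      ∃ (t : ℕ) (s : State),
        Exec redTreeCmd (input n k redAdj blueAdj) t s ∧
        t ≤ C * (G.edgeSet.ncard + 1) ∧
        ((∃ T, IsKRedSpanningTree G Er k T) →
          s.reg 2 = 1 ∧ ∃ T, IsKRedSpanningTree G Er k T ∧ Outputs s T) ∧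
        ((¬ ∃ T, IsKRedSpanningTree G Er k T) → s.reg 2 = 0) := by
  obtain ⟨C₁, hC₁⟩ := exists_exec_searchCmd arraysFst (fun _ => allCmd) 6 (by omega)
  obtain ⟨C₂, hC₂⟩ := exists_exec_searchCmd arraysSnd
    (fun c => bif c then parCmd 10 else allCmd) 12 (by omega)
  obtain ⟨C₃, hC₃⟩ := exists_exec_searchCmd arraysFst
    (fun c => bif c then allCmd else parCmd 18) 19 (by omega)
  obtain ⟨K, hK⟩ : ∃ K, K = keepCmd.size + fillCmd.size + 2 := ⟨_, rfl⟩
  -- The 9 covers six steps of the selection, the final test, one command in either branch, and the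
  -- closing `skip`.
  refine ⟨C₁ + C₂ + C₃ + K + 9, ?_⟩
  intro n k G Er Eb redAdj blueAdj hG hE hd hred hblue
  obtain ⟨r₀⟩ := hG.nonempty
  have hn : 0 < n := r₀.pos
  have : Nonempty (Fin n) := ⟨r₀⟩
  set r : Fin n := ⟨0, hn⟩
  have hErG : Er ⊆ G.edgeSet := hE ▸ Set.subset_union_left
  have hEbG : Eb ⊆ G.edgeSet := hE ▸ Set.subset_union_right
  have hedge : ∀ E : Set (Sym2 (Fin n)), E ⊆ G.edgeSet →
      (SimpleGraph.fromEdgeSet E).edgeSet = E := fun E hEG => by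
    rw [SimpleGraph.edgeSet_fromEdgeSet]
    exact sdiff_eq_left.2 (Set.disjoint_left.2 fun e he hdiag =>
      G.not_isDiag_of_mem_edgeSet (hEG he) hdiag)
  obtain ⟨Hr, hHr⟩ : ∃ Hr : SimpleGraph (Fin n), Hr.edgeSet = Er := ⟨_, hedge Er hErG⟩
  obtain ⟨Hb, hHb⟩ : ∃ Hb : SimpleGraph (Fin n), Hb.edgeSet = Eb := ⟨_, hedge Eb hEbG⟩
  subst hHr hHb
  have hGsup : G = Hr ⊔ Hb := by
    rw [← SimpleGraph.edgeSet_inj, SimpleGraph.edgeSet_sup, hE]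
  set L₁ : Bool → Fin n → List (Fin n) := fun c => bif c then blueAdj else redAdj with hL₁
  set L₂ : Bool → Fin n → List (Fin n) := fun c => bif c then redAdj else blueAdj with hL₂
  set E₁ : Bool → Set (Sym2 (Fin n)) := fun c => bif c then Hb.edgeSet else Hr.edgeSet with hE₁
  set E₂ : Bool → Set (Sym2 (Fin n)) := fun c => bif c then Hr.edgeSet else Hb.edgeSet with hE₂
  have hE₁G : ∀ c, E₁ c ⊆ G.edgeSet := by rintro (_ | _) <;> assumption
  have hE₂G : ∀ c, E₂ c ⊆ G.edgeSet := by rintro (_ | _) <;> assumption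
  have hadj₁ : ∀ c, IsAdjLists (E₁ c) (L₁ c) := by rintro (_ | _) <;> assumption
  have hadj₂ : ∀ c, IsAdjLists (E₂ c) (L₂ c) := by rintro (_ | _) <;> assumption
  have hrmem : ∀ u v, v ∈ redAdj u → Hr.Adj u v := fun u v h => ((hred u).2 v).1 h
  have hbmem : ∀ u v, v ∈ blueAdj u → Hb.Adj u v := fun u v h => ((hblue u).2 v).1 h
  -- a tree with as many red edges as possible
  obtain ⟨t₁, s₁, g₁, e₁, h₁, hi₁, hA, ht₁⟩ := hC₁ (s₀ := input n k redAdj blueAdj) (r := r)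
    (H := fun c => bif c then Hb else Hr) hG hE₁G hadj₁ (by rintro (_ | _) <;> exact subset_rfl)
    (by simpa [← hGsup] using hG) rfl
    (fun b hb => by obtain ⟨b, rfl⟩ := Nat.exists_eq_add_of_le' hb; rfl)
    (stores_fst (k := k) fun _ _ => rfl)
    (by rintro (_ | _)
        · exact isFilter_allCmd hrmem
        · exact isFilter_allCmd hbmem)
  have hA' : g₁.tree false = parGraph n (s₁.arr 10) := h₁.tree_eq false
  have hα : IsParArray n (s₁.arr 10) := h₁.isParArray hi₁ false
  simp only [cond_false, cond_true] at hA
  rw [hA'] at hA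
  have hαr : parGraph n (s₁.arr 10) ≤ Hr := hA.le₀
  -- a tree with as few red edges as possible
  obtain ⟨t₂, s₂, g₂, e₂, h₂, hi₂, hB, ht₂⟩ := hC₂ (s₀ := s₁) (r := r)
    (H := fun c => bif c then parGraph n (s₁.arr 10) else Hb) hG hE₂G hadj₂
    (by rintro (_ | _)
        · exact subset_rfl
        · exact SimpleGraph.edgeSet_mono hαr)
    (by
      refine hA.isTree.connected.mono ?_
      rw [sup_comm]
      exact sup_le_sup hA.le₁ le_rfl) rfl
    (fun b hb => by
      rw [h₁.frame b (by omega) (by omega) (by omega)]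
      obtain ⟨b, rfl⟩ := Nat.exists_eq_add_of_le' hb
      rfl)
    (stores_snd (k := k) fun b hb => h₁.frame b (by omega) (by omega) (by omega))
    (by rintro (_ | _)
        · exact isFilter_allCmd hbmem
        · exact isFilter_parCmd (b := 10) (by omega) (by omega) (by omega) hα)
  have hB' : g₂.tree true = parGraph n (s₂.arr 17) := h₂.tree_eq true
  have hβ : IsParArray n (s₂.arr 17) := h₂.isParArray hi₂ true
  simp only [cond_false, cond_true] at hB
  rw [hB'] at hB
  have h10 : s₂.arr 10 = s₁.arr 10 := h₂.frame 10 (by omega) (by omega) (by omega)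
  rw [← h10] at hA hα hαr hB
  -- the choice of the red edges
  have hreg₂ : ∀ x < 3, s₂.reg x = (input n k redAdj blueAdj).reg x := fun x hx =>
    (h₂.reg_eq x hx).trans (h₁.reg_eq x hx)
  have hfar₂ : ∀ b, 18 ≤ b → s₂.arr b = fun _ => 0 := fun b hb => by
    rw [h₂.frame b (by omega) (by omega) (by omega), h₁.frame b (by omega) (by omega) (by omega)]
    obtain ⟨b, rfl⟩ := Nat.exists_eq_add_of_le' hb
    rfl
  obtain ⟨t₃, s₃, e₃, h₃, ht₃⟩ := exec_chooseCmd (n := n) (hreg₂ 0 (by omega)) (hfar₂ 18 le_rfl)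
  obtain ⟨hγ, hBR, hRA, hcard, hmore, hless⟩ := h₃.parGraph_bounds hα hβ hB.le₁
  have hk : s₂.reg 1 = k := hreg₂ 1 (by omega)
  have hk₃ : s₃.reg 1 = k := (h₃.frame.1 1 (by omega)).trans hk
  have hnm := hG.card_vert_le_card_edgeSet_add_one
  rw [Nat.card_coe_set_eq, Nat.card_eq_fintype_card, Fintype.card_fin] at hnm
  have ht₃' : t₃ ≤ (keepCmd.size + fillCmd.size + 2) * (G.edgeSet.ncard + 1) + 6 :=
    ht₃.trans (Nat.add_le_add_right (Nat.mul_le_mul_left _ hnm) _)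
  rw [← hK] at ht₃'
  by_cases heq : s₃.reg 4 = k
  -- The third search can reach everything: `R` and the blue edges contain the second tree, because
  -- `B₁ ⊆ R`.
  · obtain ⟨t₄, s₄, g₄, e₄, h₄, hi₄, hC, ht₄⟩ := hC₃ (s₀ := s₃.setReg 2 1) (r := r)
      (H := fun c => bif c then Hb else parGraph n (s₃.arr 18)) hG hE₁G hadj₁
      (by rintro (_ | _)
          · exact SimpleGraph.edgeSet_mono (hRA.trans hαr)
          · exact subset_rfl)
      (by
        refine hB.isTree.connected.mono ?_
        rw [sup_comm]
        exact sup_le_sup hBR hB.le₀) rfl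
      (fun b hb => by
        rw [State.arr_setReg, h₃.frame.2 b (by omega), hfar₂ b (by omega)])
      (stores_fst (k := k) fun b hb => by
        rw [State.arr_setReg, h₃.frame.2 b (by omega),
          h₂.frame b (by omega) (by omega) (by omega),
          h₁.frame b (by omega) (by omega) (by omega)])
      (by rintro (_ | _)
          · exact isFilter_parCmd (b := 18) (s₀ := s₃.setReg 2 1) (by omega) (by omega)
              (by omega) hγ
          · exact isFilter_allCmd hbmem)
    have hT : IsKRedSpanningTree G Hr.edgeSet k (g₄.tree false ⊔ g₄.tree true) := by
      have := hA.isKRedSpanningTree hGsup hd hRA hC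
      rwa [← hcard, heq] at this
    refine ⟨_, s₄, .seq e₁ (.seq e₂ (.seq e₃ (.seq (.cond_true ?_ (.seq (.const _ _ _) e₄))
      (.skip _)))), ?_, fun _ => ⟨?_, _, hT, h₄.outputs hi₄⟩, fun hno => absurd ⟨_, hT⟩ hno⟩
    · exact heq.trans hk₃.symm
    · simp only [add_mul]
      omega
    · rw [h₄.reg_eq 2 (by omega)]
      simp
  · have hno : ¬ ∃ T, IsKRedSpanningTree G Hr.edgeSet k T := by
      rintro ⟨T, hT⟩
      obtain ⟨hmin, hmax⟩ := hA.red_bounds hGsup hd hB hT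
      -- Too few edges means `A₀ ⊆ R`, too many means `R ⊆ B₁`; either contradicts the bounds on
      -- `k`.
      rcases Nat.lt_or_gt_of_ne heq with hlt | hgt
      · have := Set.ncard_le_ncard (SimpleGraph.edgeSet_mono (hless (by omega)))
          (Set.toFinite _)
        omega
      · have := Set.ncard_le_ncard (SimpleGraph.edgeSet_mono (hmore (by omega)))
          (Set.toFinite _)
        omega
    refine ⟨_, s₃, .seq e₁ (.seq e₂ (.seq e₃ (.seq (.cond_false ?_ (.skip _)) (.skip _)))),
      ?_, fun hyes => absurd hyes hno, fun _ => ?_⟩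
    · exact fun h => heq (Eq.trans h hk₃)
    · simp only [add_mul]
      omega
    · rw [h₃.frame.1 2 (by omega), hreg₂ 2 (by omega)]
      rfl

/-- The priority search on the edges of two classes finds spanning trees. -/
theorem exists_spanningTreeCmd (a : Bool → ℕ) :
    ∃ C : ℕ, ∀ (n : ℕ) (G : SimpleGraph (Fin n)) (H : Bool → SimpleGraph (Fin n))
      (L : Bool → Fin n → List (Fin n)) (s₀ : State), G.Connected → G = H false ⊔ H true →
      (∀ c, IsAdjLists (H c).edgeSet (L c)) → Stores L a s₀ →
      (∀ b, 6 ≤ b → s₀.arr b = fun _ => 0) →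
      ∃ (t : ℕ) (s : State), Exec (searchCmd a (fun _ => allCmd) 6) s₀ t s ∧
        t ≤ C * (G.edgeSet.ncard + 1) ∧
        ∃ T₀ T₁, IsPriorityTree (H false) (H true) T₀ T₁ ∧ Outputs s (T₀ ⊔ T₁) := by
  obtain ⟨C, hC⟩ := exists_exec_searchCmd a (fun _ => allCmd) 6 (by omega)
  refine ⟨C, fun n G H L s₀ hG hH hadj hL hs => ?_⟩
  obtain ⟨r⟩ := hG.nonempty
  obtain ⟨t, s, g, e, h, hi, hT, ht⟩ := hC (E := fun c => (H c).edgeSet) (r := ⟨0, r.pos⟩) hG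
    (by
      rw [hH]
      rintro (_ | _)
      · exact SimpleGraph.edgeSet_mono le_sup_left
      · exact SimpleGraph.edgeSet_mono le_sup_right)
    hadj (fun _ => subset_rfl) (hH ▸ hG) rfl hs hL
    fun c => isFilter_allCmd fun u v huv => ((hadj c u).2 v).1 huv
  exact ⟨t, s, e, ht, _, _, hT, h.outputs hi⟩

/-- The subgraph of the edges of weight `i`. -/
def weightGraph {n : ℕ} (G : SimpleGraph (Fin n)) (w : Sym2 (Fin n) → ℕ) (i : ℕ) :
    SimpleGraph (Fin n) :=
  SimpleGraph.fromEdgeSet {e ∈ G.edgeSet | w e = i}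

/-! ### Splitting a graph by weight -/

section Weights

variable {n : ℕ} {G : SimpleGraph (Fin n)} {w : Sym2 (Fin n) → ℕ}

theorem edgeSet_weightGraph (i : ℕ) :
    (weightGraph G w i).edgeSet = {e ∈ G.edgeSet | w e = i} := by
  rw [weightGraph, SimpleGraph.edgeSet_fromEdgeSet]
  exact sdiff_eq_left.2 (Set.disjoint_left.2 fun e he hdiag =>
    G.not_isDiag_of_mem_edgeSet he.1 hdiag)

theorem weightGraph_sup (hw : ∀ e ∈ G.edgeSet, w e = 0 ∨ w e = 1) :
    G = weightGraph G w 0 ⊔ weightGraph G w 1 := by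
  rw [← SimpleGraph.edgeSet_inj, SimpleGraph.edgeSet_sup, edgeSet_weightGraph,
    edgeSet_weightGraph]
  ext e
  constructor
  · exact fun he => (hw e he).imp (fun h => ⟨he, h⟩) fun h => ⟨he, h⟩
  · rintro (h | h) <;> exact h.1

end Weights

end RAM

/-- Existence and construction of a `k`-red spanning tree, and construction of a minimum and of a
maximum spanning tree for weights in `{0, 1}`, each by one fixed program for all inputs, in time
`O(m)` where `m` is the number of edges (`m + 1` makes room for the graph with a single vertex).
Register `2` holds the answer to the existence question: `1` for yes, `0` for no. -/
theorem mainTheorem3 :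
    (∃ (P : RAM.Cmd) (C : ℕ),
      ∀ (n k : ℕ) (G : SimpleGraph (Fin n)) (Er Eb : Set (Sym2 (Fin n)))
        (redAdj blueAdj : Fin n → List (Fin n)),
        G.Connected → Er ∪ Eb = G.edgeSet → Disjoint Er Eb →
        RAM.IsAdjLists Er redAdj → RAM.IsAdjLists Eb blueAdj →
        ∃ (t : ℕ) (s : RAM.State),
          RAM.Exec P (RAM.input n k redAdj blueAdj) t s ∧
          t ≤ C * (G.edgeSet.ncard + 1) ∧
          ((∃ T, IsKRedSpanningTree G Er k T) →
            s.reg 2 = 1 ∧ ∃ T, IsKRedSpanningTree G Er k T ∧ RAM.Outputs s T) ∧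
          ((¬ ∃ T, IsKRedSpanningTree G Er k T) → s.reg 2 = 0)) ∧
    (∃ (P : RAM.Cmd) (C : ℕ),
      ∀ (n : ℕ) (G : SimpleGraph (Fin n)) (w : Sym2 (Fin n) → ℕ)
        (adj₀ adj₁ : Fin n → List (Fin n)),
        G.Connected → (∀ e ∈ G.edgeSet, w e = 0 ∨ w e = 1) →
        RAM.IsAdjLists {e ∈ G.edgeSet | w e = 0} adj₀ →
        RAM.IsAdjLists {e ∈ G.edgeSet | w e = 1} adj₁ →
        ∃ (t : ℕ) (s : RAM.State),
          RAM.Exec P (RAM.input n 0 adj₀ adj₁) t s ∧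
          t ≤ C * (G.edgeSet.ncard + 1) ∧
          ∃ T, IsMinSpanningTree G w T ∧ RAM.Outputs s T) ∧
    (∃ (P : RAM.Cmd) (C : ℕ),
      ∀ (n : ℕ) (G : SimpleGraph (Fin n)) (w : Sym2 (Fin n) → ℕ)
        (adj₀ adj₁ : Fin n → List (Fin n)),
        G.Connected → (∀ e ∈ G.edgeSet, w e = 0 ∨ w e = 1) →
        RAM.IsAdjLists {e ∈ G.edgeSet | w e = 0} adj₀ →
        RAM.IsAdjLists {e ∈ G.edgeSet | w e = 1} adj₁ →
        ∃ (t : ℕ) (s : RAM.State),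
          RAM.Exec P (RAM.input n 0 adj₀ adj₁) t s ∧
          t ≤ C * (G.edgeSet.ncard + 1) ∧
          ∃ T, IsMaxSpanningTree G w T ∧ RAM.Outputs s T) := by
  refine ⟨⟨RAM.redTreeCmd, RAM.exists_redTreeCmd⟩, ?_, ?_⟩
  · obtain ⟨C, hC⟩ := RAM.exists_spanningTreeCmd RAM.arraysFst
    refine ⟨RAM.searchCmd RAM.arraysFst (fun _ => RAM.allCmd) 6, C, ?_⟩
    intro n G w adj₀ adj₁ hG hw h₀ h₁
    have : Nonempty (Fin n) := hG.nonempty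
    obtain ⟨t, s, e, ht, T₀, T₁, hT, hout⟩ := hC n G
      (fun c => bif c then RAM.weightGraph G w 1 else RAM.weightGraph G w 0)
      (fun c => bif c then adj₁ else adj₀) (RAM.input n 0 adj₀ adj₁) hG (RAM.weightGraph_sup hw)
      (by rintro (_ | _) <;> simpa [RAM.edgeSet_weightGraph])
      (RAM.stores_fst (k := 0) fun _ _ => rfl)
      (fun b hb => by obtain ⟨b, rfl⟩ := Nat.exists_eq_add_of_le' hb; rfl)
    exact ⟨t, s, e, ht, _, hT.isMinSpanningTree hw (RAM.edgeSet_weightGraph 0)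
      (RAM.edgeSet_weightGraph 1), hout⟩
  -- The maximum differs from the minimum only in that the lists of weight 1 now form the preferred
  -- class.
  · obtain ⟨C, hC⟩ := RAM.exists_spanningTreeCmd RAM.arraysSnd
    refine ⟨RAM.searchCmd RAM.arraysSnd (fun _ => RAM.allCmd) 6, C, ?_⟩
    intro n G w adj₀ adj₁ hG hw h₀ h₁
    have : Nonempty (Fin n) := hG.nonempty
    obtain ⟨t, s, e, ht, T₁, T₀, hT, hout⟩ := hC n G
      (fun c => bif c then RAM.weightGraph G w 0 else RAM.weightGraph G w 1)
      (fun c => bif c then adj₀ else adj₁) (RAM.input n 0 adj₀ adj₁) hG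
      ((RAM.weightGraph_sup hw).trans (sup_comm _ _))
      (by rintro (_ | _) <;> simpa [RAM.edgeSet_weightGraph])
      (RAM.stores_snd (k := 0) fun _ _ => rfl)
      (fun b hb => by obtain ⟨b, rfl⟩ := Nat.exists_eq_add_of_le' hb; rfl)
    exact ⟨t, s, e, ht, _, hT.isMaxSpanningTree hw (RAM.edgeSet_weightGraph 0)
      (RAM.edgeSet_weightGraph 1), hout⟩
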